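/- Let $0<\beta<1$. For a nonnegative function $w\in H^1_{loc}(\mathbb R)$ with weak derivative $w'$ put $F^\beta(w)=\int_{\mathbb R}w^\beta+\int_{\mathbb R}|w'|^2\in[0,+\infty]$, and consider the problem $$\min\Big\{F^\beta(w)\;:\; w\in H^1_{loc}(\mathbb R,[0,\infty)),\ \int_{\mathbb R}w=1\Big\}.$$ This problem has a solution. Moreover, every solution $w$ (identified with its continuous representative) is compactly supported, Lipschitz continuous on $\mathbb R$, and $\mathcal C^\infty$ on the open set $\{w>0\}$. Finally, there is a solution with these properties which is in addition even and non-increasing on $[0,\infty)$. -/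

import Mathlib

open MeasureTheory Set
open scoped ContDiff ENNReal

/-- `f ∈ L²_loc(ℝ)`. -/
def MemL2loc (f : ℝ → ℝ) : Prop :=
  ∀ K : Set ℝ, IsCompact K → MemLp f 2 (volume.restrict K)

/-- `w ∈ H¹_loc(ℝ)`, with weak derivative `w'`: both functions lie in `L²_loc(ℝ)` and
`∫ w φ' = - ∫ w' φ` for all test functions `φ ∈ C_c^∞(ℝ)`. -/
structure HasWeakDerivH1loc (w w' : ℝ → ℝ) : Prop where
  memL2loc : MemL2loc w
  memL2loc_deriv : MemL2loc w'
  integral_eq : ∀ φ : ℝ → ℝ, ContDiff ℝ ∞ φ → HasCompactSupport φ →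
    ∫ x, w x * deriv φ x = -∫ x, w' x * φ x

/-- `w ∈ H¹_loc(ℝ, ℝ⁺)`, with weak derivative `w'`, and `∫ w = 1`. -/
structure IsAdmissible (w w' : ℝ → ℝ) : Prop where
  hasWeakDeriv : HasWeakDerivH1loc w w'
  nonneg : ∀ᵐ x, 0 ≤ w x
  integrable : Integrable w
  integral_eq_one : ∫ x, w x = 1

/-- The energy `∫ w ^ β + ∫ |w'| ^ 2`, with values in `[0, ∞]`, of a nonnegative function `w`
with weak derivative `w'`. -/
noncomputable def profileEnergy (β : ℝ) (w w' : ℝ → ℝ) : ℝ≥0∞ :=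
  (∫⁻ x, ENNReal.ofReal (w x ^ β)) + ∫⁻ x, ENNReal.ofReal (|w' x| ^ 2)

/-- `w` is a solution of
`min {∫ v ^ β + ∫ |v'| ^ 2 : v ∈ H¹_loc(ℝ, ℝ⁺), ∫ v = 1}`.
(The weak derivative is unique up to null sets, so the energy is a function of `w` alone.) -/
def IsOptimalProfile (β : ℝ) (w : ℝ → ℝ) : Prop :=
  ∃ w' : ℝ → ℝ, IsAdmissible w w' ∧
    ∀ v v' : ℝ → ℝ, IsAdmissible v v' → profileEnergy β w w' ≤ profileEnergy β v v'

/-- `w` is nonnegative, compactly supported, Lipschitz continuous on `ℝ`, and `C^∞` on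
`{w > 0}`. -/
structure IsRegularProfile (w : ℝ → ℝ) : Prop where
  nonneg : ∀ x, 0 ≤ w x
  hasCompactSupport : HasCompactSupport w
  lipschitz : ∃ L, LipschitzWith L w
  contDiffOn : ContDiffOn ℝ ∞ w {x | 0 < w x}

open Filter Topology

/-! The proof is a calibration argument with an explicit minimizer; it needs neither compactness nor
rearrangement. A competitor of finite energy has a continuous representative `V` that is a primitive
of its weak derivative `f`. It vanishes at infinity, so it attains a maximum `M > 0` at some `x₀`.
Put `k(s) = √(s^β - M^(β-1) s)`. To the left of `x₀`, `V^β + f² - M^(β-1) V = 2 k(V) f + (f -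
k(V))²`, and the cross term integrates exactly to `2 ∫₀ᴹ k`; the right side is handled by
reflection. For unit mass, `realEnergy_eq` thus writes the energy as `heightEnergy β M` plus two
nonnegative defects.

The function `heightEnergy β` of the height alone has a unique minimizer (`heightEnergy_lt`).
Equality therefore needs this height and the equation `|V'| = k(V)`. A solution is parametrized by
`w = M (1 - z²)^(2q+1)`, `x = C ∫₀ᶻ |1 - t²|^q dt`, where `β (2q+1) = 2q`. By
`massIntegral_eq_slopeIntegral`, the solution of unit mass has exactly the optimal height, so the
bound is attained.

Conversely, `k` is not Lipschitz at `0` and at `M`, so the equation alone allows a plateau at height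
`M`. Separation of variables (`exists_eq_extremalProfile`) shows that nothing else can happen, and a
comparison of masses removes the plateau (`eq_extremalProfile`). Every solution is a translate of
the explicit profile, from which the regularity is read off. -/

/-! ### Primitives of locally integrable functions -/

/-- `V` is a primitive of the locally integrable function `f`. -/
structure IsLocPrimitive (V f : ℝ → ℝ) : Prop where
  locallyIntegrable : LocallyIntegrable f
  sub_eq : ∀ a b, V b - V a = ∫ x in a..b, f x

theorem MemL2loc.locallyIntegrable {f : ℝ → ℝ} (hf : MemL2loc f) : LocallyIntegrable f := by
  rw [locallyIntegrable_iff]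
  intro K hK
  have : IsFiniteMeasure (volume.restrict K) := ⟨by simpa using hK.measure_lt_top⟩
  exact (hf K hK).integrable (by norm_num)

theorem Continuous.memL2loc {f : ℝ → ℝ} (hf : Continuous f) : MemL2loc f := fun K hK => by
  have : IsFiniteMeasure (volume.restrict K) := ⟨by simpa using hK.measure_lt_top⟩
  obtain ⟨C, hC⟩ := hK.exists_bound_of_continuousOn hf.continuousOn
  exact MemLp.of_bound hf.aestronglyMeasurable C
    ((ae_restrict_iff' hK.measurableSet).2 (ae_of_all _ hC))

theorem MeasureTheory.LocallyIntegrable.intervalIntegrable {f : ℝ → ℝ} (hf : LocallyIntegrable f)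
    {a b : ℝ} : IntervalIntegrable f volume a b :=
  (hf.integrableOn_isCompact isCompact_uIcc).intervalIntegrable

theorem MeasureTheory.LocallyIntegrable.isLocPrimitive {f : ℝ → ℝ} (hf : LocallyIntegrable f)
    (c v : ℝ) : IsLocPrimitive (fun x => v + ∫ t in c..x, f t) f where
  locallyIntegrable := hf
  sub_eq a b := by
    have h := fun a b => (hf.intervalIntegrable (a := a) (b := b))
    rw [← intervalIntegral.integral_interval_sub_left (h c b) (h c a)]
    ring

namespace IsLocPrimitive

variable {V f : ℝ → ℝ}

theorem eq_add (h : IsLocPrimitive V f) (a : ℝ) : V = fun x => V a + ∫ t in a..x, f t := by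
  ext x
  rw [← h.sub_eq]; ring

theorem absolutelyContinuousOnInterval (h : IsLocPrimitive V f) (a b : ℝ) :
    AbsolutelyContinuousOnInterval V a b := by
  have h1 : AbsolutelyContinuousOnInterval (fun _ : ℝ => V a) a b :=
    (contDiff_const (n := 1)).contDiffOn.absolutelyContinuousOnInterval
  have h2 := h1.add ((h.locallyIntegrable.intervalIntegrable
    (a := a) (b := b)).absolutelyContinuousOnInterval_intervalIntegral left_mem_uIcc)
  rwa [h.eq_add a]

theorem ae_hasDerivAt (h : IsLocPrimitive V f) : ∀ᵐ x, HasDerivAt V (f x) x := by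
  filter_upwards [_root_.LocallyIntegrable.ae_hasDerivAt_integral h.locallyIntegrable] with x hx
  rw [h.eq_add 0]
  exact (hx 0).const_add _

theorem continuous (h : IsLocPrimitive V f) : Continuous V := by
  rw [h.eq_add 0]
  exact continuous_const.add (intervalIntegral.continuous_primitive
    (fun a b => h.locallyIntegrable.intervalIntegrable) 0)

theorem integral_mul_deriv (h : IsLocPrimitive V f) {φ : ℝ → ℝ} (hφ : ContDiff ℝ 1 φ)
    (hs : HasCompactSupport φ) : ∫ x, V x * deriv φ x = -∫ x, f x * φ x := by
  obtain ⟨R, hR⟩ := hs.isCompact.isBounded.subset_ball 0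
  rw [Real.ball_eq_Ioo] at hR
  simp only [zero_sub, zero_add] at hR
  have hsub : tsupport φ ⊆ Ioc (-R) R := hR.trans Ioo_subset_Ioc_self
  have h1 : ∫ x, V x * deriv φ x = ∫ x in (-R)..R, V x * deriv φ x := by
    refine (intervalIntegral.integral_eq_integral_of_support_subset ?_).symm
    refine (Function.support_mul_subset_right _ _).trans ?_
    exact (support_deriv_subset).trans hsub
  have h2 : ∫ x, f x * φ x = ∫ x in (-R)..R, f x * φ x := by
    refine (intervalIntegral.integral_eq_integral_of_support_subset ?_).symm
    exact (Function.support_mul_subset_right _ _).trans ((subset_tsupport _).trans hsub)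
  have z : ∀ y, y ∉ Ioo (-R) R → φ y = 0 := fun y hy =>
    image_eq_zero_of_notMem_tsupport fun hy' => hy (hR hy')
  rw [h1, h2, (h.absolutelyContinuousOnInterval _ _).integral_mul_deriv_eq_deriv_mul
    hφ.contDiffOn.absolutelyContinuousOnInterval, z R (by simp), z (-R) (by simp)]
  simp only [mul_zero, sub_zero, zero_sub, neg_inj]
  refine intervalIntegral.integral_congr_ae ?_
  filter_upwards [h.ae_hasDerivAt] with x hx _
  rw [hx.deriv]

/-- Chain rule for a `C¹` function of a primitive, in integrated form. -/
theorem integral_comp_mul (h : IsLocPrimitive V f) {k : ℝ → ℝ} (hk : Continuous k) (a b : ℝ) :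
    ∫ x in a..b, k (V x) * f x = ∫ s in V a..V b, k s := by
  set Φ : ℝ → ℝ := fun s => ∫ t in (0 : ℝ)..s, k t
  have hΦ : ∀ s, HasDerivAt Φ (k s) s := fun s =>
    intervalIntegral.integral_hasDerivAt_right (hk.intervalIntegrable _ _)
      (hk.stronglyMeasurableAtFilter _ _) hk.continuousAt
  have hΦ1 : ContDiff ℝ 1 Φ := by
    rw [contDiff_one_iff_deriv]
    refine ⟨fun s => (hΦ s).differentiableAt, ?_⟩
    rwa [show deriv Φ = k from funext fun s => (hΦ s).deriv]
  obtain ⟨m, hm⟩ := (isCompact_uIcc (a := a) (b := b)).exists_bound_of_continuousOn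
    h.continuous.continuousOn
  have hmaps : MapsTo V (uIcc a b) (Icc (-m) m) := fun x hx => abs_le.1 (hm x hx)
  obtain ⟨K, hK⟩ := hΦ1.contDiffOn.exists_lipschitzOnWith (by decide) (convex_Icc (-m) m)
    isCompact_Icc
  -- `Φ` is Lipschitz on the bounded range of `V`, and a Lipschitz function of an absolutely
  -- continuous one is absolutely continuous. Dividing by `K + 1` covers the case `K = 0`.
  have hac : AbsolutelyContinuousOnInterval (fun x => Φ (V x)) a b := by
    have h0 := h.absolutelyContinuousOnInterval a b
    rw [absolutelyContinuousOnInterval_iff] at h0 ⊢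
    intro ε hε
    obtain ⟨δ, hδ, H⟩ := h0 (ε / (K + 1)) (by positivity)
    refine ⟨δ, hδ, fun E hE hE' => ?_⟩
    have H' := H E hE hE'
    calc
      _ ≤ ∑ i ∈ Finset.range E.1, K * dist (V (E.2 i).1) (V (E.2 i).2) := by
        refine Finset.sum_le_sum fun i hi => ?_
        exact hK.dist_le_mul _ (hmaps (hE.1 i hi).1) _ (hmaps (hE.1 i hi).2)
      _ = K * ∑ i ∈ Finset.range E.1, dist (V (E.2 i).1) (V (E.2 i).2) :=
        (Finset.mul_sum _ _ _).symm
      _ ≤ K * (ε / (K + 1)) := by gcongr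
      _ < (K + 1) * (ε / (K + 1)) := by gcongr; linarith
      _ = ε := by field
  have e := hac.integral_deriv_eq_sub
  rw [← intervalIntegral.integral_interval_sub_left (hk.intervalIntegrable 0 (V b))
    (hk.intervalIntegrable 0 (V a))]
  change _ = Φ (V b) - Φ (V a)
  rw [← e]
  refine intervalIntegral.integral_congr_ae ?_
  filter_upwards [h.ae_hasDerivAt] with x hx _
  exact ((hΦ (V x)).comp x hx).deriv.symm

end IsLocPrimitive

/-- Du Bois-Reymond's lemma. -/
theorem ae_eq_const_of_integral_mul_deriv_eq_zero {u : ℝ → ℝ} (hu : LocallyIntegrable u)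
    (h : ∀ φ : ℝ → ℝ, ContDiff ℝ ∞ φ → HasCompactSupport φ → ∫ x, u x * deriv φ x = 0) :
    ∃ c, ∀ᵐ x, u x = c := by
  obtain ⟨η⟩ : Nonempty (ContDiffBump (0 : ℝ)) := inferInstance
  set ρ : ℝ → ℝ := η.normed volume
  have hρ : ContDiff ℝ ∞ ρ := η.contDiff_normed
  have hρs : HasCompactSupport ρ := η.hasCompactSupport_normed
  have hρ1 : ∫ x, ρ x = 1 := η.integral_normed
  have hui : ∀ ψ : ℝ → ℝ, Continuous ψ → HasCompactSupport ψ → Integrable fun x => ψ x * u x :=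
    fun ψ h1 h2 => hu.integrable_smul_left_of_hasCompactSupport h1 h2
  have hc : LocallyIntegrable (fun _ : ℝ => ∫ x, ρ x * u x) volume := locallyIntegrable_const _
  refine ⟨∫ x, ρ x * u x, ae_eq_of_integral_contDiff_smul_eq hu hc fun ψ hψ hψs => ?_⟩
  set I := ∫ x, ψ x
  -- Subtracting a multiple of a unit-mass bump makes the mean zero, so the primitive of `d` has
  -- compact support and is a legitimate test function.
  set d : ℝ → ℝ := fun x => ψ x - I * ρ x
  have hd : ContDiff ℝ ∞ d := hψ.sub (contDiff_const.mul hρ)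
  have hds : HasCompactSupport d := hψs.sub (hρs.mul_left)
  have hdI : ∫ x, d x = 0 := by
    rw [integral_sub (hψ.continuous.integrable_of_hasCompactSupport hψs)
      ((hρ.continuous.integrable_of_hasCompactSupport hρs).const_mul _), integral_const_mul, hρ1]
    simp [I]
  obtain ⟨R, hR⟩ := hds.isCompact.isBounded.subset_ball 0
  rw [Real.ball_eq_Ioo] at hR
  simp only [zero_sub, zero_add] at hR
  set φ : ℝ → ℝ := fun x => ∫ t in (-R)..x, d t
  have hφd : ∀ x, HasDerivAt φ (d x) x := fun s =>
    intervalIntegral.integral_hasDerivAt_right (hd.continuous.intervalIntegrable _ _)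
      (hd.continuous.stronglyMeasurableAtFilter _ _) hd.continuous.continuousAt
  have hφ' : deriv φ = d := funext fun s => (hφd s).deriv
  have hφ : ContDiff ℝ ∞ φ := by
    rw [contDiff_infty_iff_deriv]
    exact ⟨fun s => (hφd s).differentiableAt, hφ' ▸ hd⟩
  have hd0 : ∀ x, x ∉ Ioo (-R) R → d x = 0 := fun x hx =>
    image_eq_zero_of_notMem_tsupport fun hx' => hx (hR hx')
  have hφs : HasCompactSupport φ := by
    refine HasCompactSupport.intro (isCompact_Icc (a := -R) (b := R)) fun x hx => ?_
    rw [mem_Icc, not_and_or, not_le, not_le] at hx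
    rcases hx with hx | hx
    · refine (intervalIntegral.integral_congr (g := fun _ => (0 : ℝ)) fun t ht => ?_).trans
        (by simp)
      refine hd0 t fun ht' => ?_
      rw [uIcc_of_ge hx.le] at ht
      exact absurd ht.2 (not_le.2 ht'.1)
    · rw [← hdI]
      refine intervalIntegral.integral_eq_integral_of_support_subset ?_
      exact ((subset_tsupport _).trans hR).trans
        (fun y hy => ⟨hy.1, hy.2.le.trans hx.le⟩)
  have key := h φ hφ hφs
  rw [hφ'] at key
  have e : ∀ x, u x * d x = ψ x * u x - I * (ρ x * u x) := fun x => by simp only [d]; ring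
  simp_rw [e] at key
  rw [integral_sub (hui ψ hψ.continuous hψs) ((hui ρ hρ.continuous hρs).const_mul _),
    integral_const_mul, sub_eq_zero] at key
  simp only [smul_eq_mul]
  rw [key, integral_mul_const]

/-- A function in `H¹_loc(ℝ)` has a representative that is a primitive of its weak derivative. -/
theorem HasWeakDerivH1loc.exists_isLocPrimitive {w w' : ℝ → ℝ} (h : HasWeakDerivH1loc w w') :
    ∃ V, V =ᵐ[volume] w ∧ IsLocPrimitive V w' := by
  have hw := h.memL2loc.locallyIntegrable
  have hP := h.memL2loc_deriv.locallyIntegrable.isLocPrimitive 0 0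
  set P : ℝ → ℝ := fun x => 0 + ∫ t in (0 : ℝ)..x, w' t
  obtain ⟨c, hc⟩ := ae_eq_const_of_integral_mul_deriv_eq_zero
    (hw.sub hP.continuous.locallyIntegrable) fun φ hφ hφs => by
      have hd : Continuous (deriv φ) := hφ.continuous_deriv (by simp)
      have i : ∀ g : ℝ → ℝ, LocallyIntegrable g → Integrable fun x => g x * deriv φ x :=
        fun g hg => hg.integrable_smul_right_of_hasCompactSupport hd hφs.deriv
      have e : ∀ x, (w - P) x * deriv φ x = w x * deriv φ x - P x * deriv φ x :=
        fun x => by simp only [Pi.sub_apply]; ring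
      simp_rw [e]
      rw [integral_sub (i w hw) (i P hP.continuous.locallyIntegrable), h.integral_eq φ hφ hφs,
        hP.integral_mul_deriv (hφ.of_le (by simp)) hφs, sub_self]
  refine ⟨fun x => c + ∫ t in (0 : ℝ)..x, w' t, ?_,
    h.memL2loc_deriv.locallyIntegrable.isLocPrimitive 0 c⟩
  filter_upwards [hc] with x hx
  simp only [Pi.sub_apply, P] at hx
  linarith

/-! ### Continuous representatives of finite energy -/

/-- `V ≥ 0` is a primitive of `f`, and the mass and energy integrals are finite. -/
structure IsEnergyProfile (β : ℝ) (V f : ℝ → ℝ) : Prop extends IsLocPrimitive V f where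
  nonneg : ∀ x, 0 ≤ V x
  integrable : Integrable V
  integrable_rpow : Integrable fun x => V x ^ β
  integrable_sq : Integrable fun x => f x ^ 2

/-- The energy as a real number. -/
noncomputable def realEnergy (β : ℝ) (V f : ℝ → ℝ) : ℝ := (∫ x, V x ^ β) + ∫ x, f x ^ 2

theorem MeasureTheory.LocallyIntegrable.memL2loc {f : ℝ → ℝ} (hf : LocallyIntegrable f)
    (h : Integrable fun x => f x ^ 2) : MemL2loc f := fun K _ =>
  ((memLp_two_iff_integrable_sq hf.aestronglyMeasurable).2 h).restrict K

namespace IsEnergyProfile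

variable {β : ℝ} {V f : ℝ → ℝ}

theorem aestronglyMeasurable_deriv (h : IsEnergyProfile β V f) : AEStronglyMeasurable f volume :=
  h.locallyIntegrable.aestronglyMeasurable

theorem isAdmissible (h : IsEnergyProfile β V f) (h1 : ∫ x, V x = 1) : IsAdmissible V f where
  hasWeakDeriv :=
    { memL2loc := h.toIsLocPrimitive.continuous.memL2loc
      memL2loc_deriv := h.locallyIntegrable.memL2loc h.integrable_sq
      integral_eq := fun φ hφ hφs => h.integral_mul_deriv (hφ.of_le (by simp)) hφs }
  nonneg := ae_of_all _ h.nonneg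
  integrable := h.integrable
  integral_eq_one := h1

theorem profileEnergy_eq (h : IsEnergyProfile β V f) :
    profileEnergy β V f = ENNReal.ofReal (realEnergy β V f) := by
  rw [profileEnergy, realEnergy, ENNReal.ofReal_add
    (integral_nonneg fun x => Real.rpow_nonneg (h.nonneg x) _)
    (integral_nonneg fun _ => sq_nonneg _),
    ofReal_integral_eq_lintegral_ofReal h.integrable_rpow
      (ae_of_all _ fun x => Real.rpow_nonneg (h.nonneg x) _),
    ofReal_integral_eq_lintegral_ofReal h.integrable_sq (ae_of_all _ fun x => sq_nonneg _)]
  simp only [sq_abs]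

theorem realEnergy_nonneg (h : IsEnergyProfile β V f) : 0 ≤ realEnergy β V f :=
  add_nonneg (integral_nonneg fun x => Real.rpow_nonneg (h.nonneg x) _)
    (integral_nonneg fun x => sq_nonneg _)

/-- Reflection lets every later argument be carried out on a left half-line only. -/
theorem comp_neg (h : IsEnergyProfile β V f) :
    IsEnergyProfile β (fun x => V (-x)) (fun x => -f (-x)) where
  locallyIntegrable := by
    have : LocallyIntegrable (fun x => f (-x)) := by
      refine (locallyIntegrable_iff).2 fun K hK => ?_
      have := (h.locallyIntegrable.integrableOn_isCompact hK.neg)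
      have e := (Measure.measurePreserving_neg (volume : Measure ℝ)).integrableOn_comp_preimage
        (Homeomorph.neg ℝ).measurableEmbedding (f := f) (s := -K)
      have e2 : (Neg.neg : ℝ → ℝ) ⁻¹' (-K) = K := by ext; simp
      rw [e2] at e
      exact e.2 this
    exact this.neg
  sub_eq a b := by
    rw [intervalIntegral.integral_neg, intervalIntegral.integral_comp_neg, h.sub_eq,
      intervalIntegral.integral_symm]
  nonneg x := h.nonneg _
  integrable := h.integrable.comp_neg
  integrable_rpow := h.integrable_rpow.comp_neg
  integrable_sq := by simpa using h.integrable_sq.comp_neg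

/-- Young's inequality dominates the product by the energy density. -/
theorem integrable_mul (h : IsEnergyProfile β V f) {k : ℝ → ℝ} (hk : Continuous k)
    (hkV : ∀ x, k (V x) ^ 2 ≤ V x ^ β) : Integrable fun x => k (V x) * f x := by
  refine (h.integrable_rpow.add h.integrable_sq).mono'
    ((hk.comp h.toIsLocPrimitive.continuous).aestronglyMeasurable.mul h.aestronglyMeasurable_deriv)
    (ae_of_all _ fun x => ?_)
  rw [Real.norm_eq_abs, Pi.add_apply, abs_le]
  constructor <;> nlinarith [hkV x, sq_nonneg (k (V x) + f x), sq_nonneg (k (V x) - f x),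
    sq_nonneg (k (V x)), sq_nonneg (f x)]

/-- The derivative of `V^(β/2+1)` is a multiple of `V^(β/2) f`, which is integrable. So `V` has a
limit, and integrability of `V` forces it to be `0`. -/
theorem tendsto_atBot (h : IsEnergyProfile β V f) (hβ : 0 < β) : Tendsto V atBot (𝓝 0) := by
  have hk : Continuous fun s : ℝ => s ^ (β / 2) := Real.continuous_rpow_const (by positivity)
  have hG := h.integrable_mul hk fun x => by
    rw [← Real.rpow_natCast, ← Real.rpow_mul (h.nonneg x)]
    norm_num
  set γ := β / 2 + 1
  have hγ : 0 < γ := by positivity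
  have e : ∀ x, V x ^ γ = V 0 ^ γ - γ * ∫ y in x..0, V y ^ (β / 2) * f y := fun x => by
    rw [h.integral_comp_mul hk, integral_rpow (Or.inl (by linarith))]
    change _ = _ - γ * ((_ ^ γ - _ ^ γ) / γ)
    field_simp
    ring
  have hT := (intervalIntegral_tendsto_integral_Iic 0 hG.integrableOn tendsto_id).const_mul γ
    |>.const_sub (V 0 ^ γ)
  simp only [id_eq] at hT
  simp_rw [← e] at hT
  have hT' := hT.rpow_const (p := γ⁻¹) (Or.inr (by positivity))
  have e' : ∀ x, (V x ^ γ) ^ γ⁻¹ = V x := fun x => Real.rpow_rpow_inv (h.nonneg x) hγ.ne'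
  simp_rw [e'] at hT'
  have := (h.integrable.integrableAtFilter atBot).eq_zero_of_tendsto (fun s hs => by
    obtain ⟨a, ha⟩ := mem_atBot_sets.1 hs
    exact measure_mono_top (fun x hx => ha x hx) (Real.volume_Iic (a := a))) hT'
  rwa [this] at hT'

theorem tendsto_atTop (h : IsEnergyProfile β V f) (hβ : 0 < β) : Tendsto V atTop (𝓝 0) := by
  simpa [Function.comp_def] using (h.comp_neg.tendsto_atBot hβ).comp tendsto_neg_atTop_atBot

theorem exists_isMax (h : IsEnergyProfile β V f) (hβ : 0 < β) (hV : ∫ x, V x ≠ 0) :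
    ∃ x₀, 0 < V x₀ ∧ ∀ x, V x ≤ V x₀ := by
  have hex : ∃ y, 0 < V y := by
    by_contra! H
    exact hV (by simp [fun x => le_antisymm (H x) (h.nonneg x)])
  obtain ⟨y, hy⟩ := hex
  obtain ⟨x₀, hx₀⟩ := h.toIsLocPrimitive.continuous.exists_forall_ge' y (by
    rw [cocompact_eq_atBot_atTop, eventually_sup]
    exact ⟨(h.tendsto_atBot hβ).eventually (eventually_le_nhds hy),
      (h.tendsto_atTop hβ).eventually (eventually_le_nhds hy)⟩)
  exact ⟨x₀, hy.trans_le (hx₀ y), hx₀⟩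

end IsEnergyProfile

/-- An admissible function of finite energy has a continuous representative. -/
theorem IsAdmissible.exists_isEnergyProfile {β : ℝ} {w w' : ℝ → ℝ} (h : IsAdmissible w w')
    (hE : profileEnergy β w w' ≠ ⊤) :
    ∃ V, V =ᵐ[volume] w ∧ IsEnergyProfile β V w' ∧ ∫ x, V x = 1 ∧
      profileEnergy β w w' = ENNReal.ofReal (realEnergy β V w') := by
  obtain ⟨V, hVw, hV⟩ := h.hasWeakDeriv.exists_isLocPrimitive
  rw [profileEnergy, ENNReal.add_ne_top] at hE
  have hpos : ∀ x, 0 ≤ V x := by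
    -- Two continuous functions that agree almost everywhere agree everywhere, which turns
    -- nonnegativity almost everywhere into nonnegativity.
    have : V = fun x => |V x| := by
      refine (hV.continuous.ae_eq_iff_eq volume hV.continuous.abs).1 ?_
      filter_upwards [hVw, h.nonneg] with x hx hx'
      rw [hx, abs_of_nonneg hx']
    intro x
    rw [this]
    exact abs_nonneg _
  have hVE : IsEnergyProfile β V w' :=
    { toIsLocPrimitive := hV
      nonneg := hpos
      integrable := h.integrable.congr hVw.symm
      integrable_rpow := by
        refine (lintegral_ofReal_ne_top_iff_integrable ?_
          (ae_of_all _ fun x => Real.rpow_nonneg (hpos x) _)).1 ?_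
        · exact (hV.continuous.aemeasurable.pow_const β).aestronglyMeasurable
        · rw [lintegral_congr_ae (g := fun x => ENNReal.ofReal (w x ^ β))]
          · exact hE.1
          · filter_upwards [hVw] with x hx
            rw [hx]
      integrable_sq := by
        refine (lintegral_ofReal_ne_top_iff_integrable ?_ (ae_of_all _ fun x => sq_nonneg _)).1 ?_
        · exact hV.locallyIntegrable.aestronglyMeasurable.pow 2
        · simpa only [sq_abs] using hE.2 }
  refine ⟨V, hVw, hVE, by rw [integral_congr_ae hVw, h.integral_eq_one], ?_⟩
  rw [← hVE.profileEnergy_eq, profileEnergy, profileEnergy]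
  congr 1
  refine lintegral_congr_ae ?_
  filter_upwards [hVw] with x hx
  rw [hx]

/-! ### The calibration identity -/

/-- The potential `s ^ β - M ^ (β - 1) s`, which vanishes at `0` and at `M`. -/
noncomputable def wellPotential (β M s : ℝ) : ℝ := s ^ β - M ^ (β - 1) * s

/-- The slope `√(s ^ β - M ^ (β - 1) s)` of the optimal profile of height `M` at level `s`. -/
noncomputable def profileSlope (β M s : ℝ) : ℝ := √(wellPotential β M s)

theorem wellPotential_mul {β M u : ℝ} (hM : 0 < M) (hu : 0 ≤ u) :
    wellPotential β M (M * u) = M ^ β * (u ^ β - u) := by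
  rw [wellPotential, Real.mul_rpow hM.le hu, ← mul_assoc, Real.rpow_sub_one hM.ne',
    div_mul_cancel₀ _ hM.ne']
  ring

theorem wellPotential_nonneg {β M s : ℝ} (hβ : β ≤ 1) (hM : 0 < M) (h0 : 0 ≤ s) (h1 : s ≤ M) :
    0 ≤ wellPotential β M s := by
  have hu : 0 ≤ s / M := by positivity
  rw [show s = M * (s / M) by field_simp, wellPotential_mul hM hu]
  have : s / M ≤ (s / M) ^ β := Real.self_le_rpow_of_le_one hu ((div_le_one hM).2 h1) hβ
  have := Real.rpow_nonneg hM.le β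
  nlinarith

theorem continuous_profileSlope {β : ℝ} (hβ : 0 < β) (M : ℝ) : Continuous (profileSlope β M) :=
  ((Real.continuous_rpow_const hβ.le).sub (continuous_const.mul continuous_id)).sqrt

theorem profileSlope_nonneg (β M s : ℝ) : 0 ≤ profileSlope β M s := Real.sqrt_nonneg _

theorem profileSlope_sq {β M s : ℝ} (hβ : β ≤ 1) (hM : 0 < M) (h0 : 0 ≤ s) (h1 : s ≤ M) :
    profileSlope β M s ^ 2 = s ^ β - M ^ (β - 1) * s :=
  Real.sq_sqrt (wellPotential_nonneg hβ hM h0 h1)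

theorem profileSlope_mul {β M u : ℝ} (hM : 0 < M) (hu : 0 ≤ u) :
    profileSlope β M (M * u) = M ^ (β / 2) * √(u ^ β - u) := by
  rw [profileSlope, wellPotential_mul hM hu, Real.sqrt_mul (Real.rpow_nonneg hM.le _),
    Real.sqrt_eq_rpow, ← Real.rpow_mul hM.le]
  ring_nf

/-- The constant `∫ √(t ^ β - t)` over the unit interval. -/
noncomputable def slopeIntegral (β : ℝ) : ℝ := ∫ t in (0 : ℝ)..1, √(t ^ β - t)

/-- Scaling `s = M u`: the measure contributes `M` and the slope `M^(β/2)`. -/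
theorem integral_profileSlope {β M : ℝ} (hM : 0 < M) :
    ∫ s in (0 : ℝ)..M, profileSlope β M s = M ^ (1 + β / 2) * slopeIntegral β := by
  have := intervalIntegral.smul_integral_comp_mul_left (a := 0) (b := 1) (profileSlope β M) M
  rw [mul_zero, mul_one, smul_eq_mul] at this
  rw [← this, slopeIntegral, Real.rpow_add hM, Real.rpow_one, mul_assoc,
    ← intervalIntegral.integral_const_mul (M ^ (β / 2))]
  congr 1
  refine intervalIntegral.integral_congr fun u hu => ?_
  rw [uIcc_of_le zero_le_one] at hu
  exact profileSlope_mul hM hu.1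

namespace IsEnergyProfile

variable {β : ℝ} {V f : ℝ → ℝ}

theorem integrable_slope_mul (h : IsEnergyProfile β V f) (hβ₀ : 0 < β) (hβ₁ : β ≤ 1) {M : ℝ}
    (hM : 0 < M) (hVM : ∀ x, V x ≤ M) : Integrable fun x => profileSlope β M (V x) * f x :=
  h.integrable_mul (continuous_profileSlope hβ₀ M) fun x => by
    rw [profileSlope_sq hβ₁ hM (h.nonneg x) (hVM x)]
    have := mul_nonneg (Real.rpow_nonneg hM.le (β - 1)) (h.nonneg x)
    linarith

theorem integrable_sub_slope_sq (h : IsEnergyProfile β V f) (hβ₀ : 0 < β) (hβ₁ : β ≤ 1) {M : ℝ}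
    (hM : 0 < M) (hVM : ∀ x, V x ≤ M) :
    Integrable fun x => (f x - profileSlope β M (V x)) ^ 2 := by
  have e : ∀ x, (f x - profileSlope β M (V x)) ^ 2 =
      V x ^ β + f x ^ 2 - M ^ (β - 1) * V x - 2 * (profileSlope β M (V x) * f x) := fun x => by
    linear_combination profileSlope_sq hβ₁ hM (h.nonneg x) (hVM x)
  simp_rw [e]
  exact ((h.integrable_rpow.add h.integrable_sq).sub (h.integrable.const_mul _)).sub
    ((h.integrable_slope_mul hβ₀ hβ₁ hM hVM).const_mul _)

/-- Completing the square leaves the cross term `2 k(V) f`, the derivative of `2 K(V)` for a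
primitive `K` of the slope `k`. Its integral depends only on the end values of `V`, namely `0` at
`-∞` and the maximum at `x₀`. -/
theorem integral_Iic_eq (h : IsEnergyProfile β V f) (hβ₀ : 0 < β) (hβ₁ : β ≤ 1) {x₀ : ℝ}
    (hM : 0 < V x₀) (hVM : ∀ x, V x ≤ V x₀) :
    ∫ x in Iic x₀, (V x ^ β + f x ^ 2 - V x₀ ^ (β - 1) * V x) =
      2 * (V x₀ ^ (1 + β / 2) * slopeIntegral β) +
        ∫ x in Iic x₀, (f x - profileSlope β (V x₀) (V x)) ^ 2 := by
  set M := V x₀ with hMdef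
  have hG := h.integrable_slope_mul hβ₀ hβ₁ hM hVM
  have hkc := continuous_profileSlope hβ₀ M
  have h1 : ∫ x in Iic x₀, profileSlope β M (V x) * f x = M ^ (1 + β / 2) * slopeIntegral β := by
    rw [← integral_profileSlope hM]
    refine tendsto_nhds_unique (intervalIntegral_tendsto_integral_Iic x₀ hG.integrableOn tendsto_id)
      ?_
    have e : ∀ y, -∫ s in M..V y, profileSlope β M s = ∫ x in y..x₀, profileSlope β M (V x) * f x :=
      fun y => by rw [h.integral_comp_mul hkc, ← intervalIntegral.integral_symm]
    rw [intervalIntegral.integral_symm]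
    refine Tendsto.congr e ?_
    have hc : Continuous fun y => -∫ s in M..y, profileSlope β M s :=
      (intervalIntegral.continuous_primitive (fun a b => hkc.intervalIntegrable a b) M).neg
    exact (hc.tendsto 0).comp (h.tendsto_atBot hβ₀)
  have e : ∀ x, V x ^ β + f x ^ 2 - M ^ (β - 1) * V x =
      2 * (profileSlope β M (V x) * f x) + (f x - profileSlope β M (V x)) ^ 2 := fun x => by
    linear_combination -profileSlope_sq hβ₁ hM (h.nonneg x) (hVM x)
  simp_rw [e]
  rw [integral_add (hG.const_mul 2).integrableOn
    (h.integrable_sub_slope_sq hβ₀ hβ₁ hM hVM).integrableOn, integral_const_mul, h1]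

/-- The half-line identity is applied to `V` and to its reflection; each side contributes two slope
integrals. -/
theorem realEnergy_eq (h : IsEnergyProfile β V f) (hβ₀ : 0 < β) (hβ₁ : β ≤ 1) {x₀ : ℝ}
    (hM : 0 < V x₀) (hVM : ∀ x, V x ≤ V x₀) :
    realEnergy β V f = V x₀ ^ (β - 1) * (∫ x, V x) + 4 * slopeIntegral β * V x₀ ^ (1 + β / 2) +
      ((∫ x in Iic x₀, (f x - profileSlope β (V x₀) (V x)) ^ 2) +
        ∫ x in Iic (-x₀), (-f (-x) - profileSlope β (V x₀) (V (-x))) ^ 2) := by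
  have h1 := h.integral_Iic_eq hβ₀ hβ₁ hM hVM
  have h2 := h.comp_neg.integral_Iic_eq (x₀ := -x₀) hβ₀ hβ₁ (by simpa using hM)
    (fun x => by simpa using hVM (-x))
  simp only [neg_neg, neg_sq] at h2
  have h3 := integral_comp_neg_Iic (-x₀)
    (fun x => V x ^ β + f x ^ 2 - V x₀ ^ (β - 1) * V x)
  simp only [neg_neg] at h3
  rw [h3] at h2
  have hi' : Integrable fun x => V x ^ β + f x ^ 2 := h.integrable_rpow.add h.integrable_sq
  have hi : Integrable fun x => V x ^ β + f x ^ 2 - V x₀ ^ (β - 1) * V x :=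
    hi'.sub (h.integrable.const_mul _)
  have h4 := intervalIntegral.integral_Iic_add_Ioi (b := x₀) hi.integrableOn hi.integrableOn
  rw [integral_sub hi' (h.integrable.const_mul _),
    integral_add h.integrable_rpow h.integrable_sq, integral_const_mul, h1, h2] at h4
  rw [realEnergy]
  linarith

end IsEnergyProfile

/-! ### The explicit extremal profile -/

/-- The position `x` as a function of the parameter `z` on the extremal profile. -/
noncomputable def profileTime (q C z : ℝ) : ℝ := C * ∫ t in (0 : ℝ)..z, |1 - t ^ 2| ^ q

/-- The parameter `z` as a function of the position `x` on the extremal profile. -/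
noncomputable def profileCoord (q C : ℝ) : ℝ → ℝ := Function.invFun (profileTime q C)

/-- The positive part of `1 - z ^ 2`, as a function of the position. -/
noncomputable def profileCap (q C x : ℝ) : ℝ := max (1 - profileCoord q C x ^ 2) 0

/-- The extremal profile of height `M`. -/
noncomputable def extremalProfile (q C M x : ℝ) : ℝ := M * profileCap q C x ^ (2 * q + 1)

/-- The derivative of the extremal profile. -/
noncomputable def extremalDeriv (q C M x : ℝ) : ℝ :=
  -(2 * (2 * q + 1) * M / C) * profileCoord q C x * profileCap q C x ^ q

/-! ### The change of variable between position and parameter -/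

section Time

variable {q C : ℝ}

theorem continuous_abs_one_sub_sq_rpow (hq : 0 ≤ q) : Continuous fun t : ℝ => |1 - t ^ 2| ^ q :=
  (by fun_prop : Continuous fun t : ℝ => |1 - t ^ 2|).rpow_const fun _ => Or.inr hq

theorem hasDerivAt_profileTime (hq : 0 ≤ q) (C z : ℝ) :
    HasDerivAt (profileTime q C) (C * |1 - z ^ 2| ^ q) z := by
  have hc := continuous_abs_one_sub_sq_rpow hq
  exact (intervalIntegral.integral_hasDerivAt_right (hc.intervalIntegrable _ _)
    (hc.stronglyMeasurableAtFilter _ _) hc.continuousAt).const_mul C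

theorem continuous_profileTime (hq : 0 ≤ q) (C : ℝ) : Continuous (profileTime q C) :=
  continuous_iff_continuousAt.2 fun z => (hasDerivAt_profileTime hq C z).continuousAt

theorem profileTime_zero (q C : ℝ) : profileTime q C 0 = 0 := by simp [profileTime]

theorem profileTime_neg (q C z : ℝ) : profileTime q C (-z) = -profileTime q C z := by
  have := intervalIntegral.integral_comp_neg (a := 0) (b := z) fun t : ℝ => |1 - t ^ 2| ^ q
  simp only [neg_sq, neg_zero] at this
  rw [profileTime, profileTime, intervalIntegral.integral_symm, ← this]
  ring

theorem profileTime_sub (hq : 0 ≤ q) (C a b : ℝ) :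
    profileTime q C b - profileTime q C a = C * ∫ t in a..b, |1 - t ^ 2| ^ q := by
  have hc := continuous_abs_one_sub_sq_rpow hq
  rw [← intervalIntegral.integral_interval_sub_left (hc.intervalIntegrable 0 b)
    (hc.intervalIntegrable 0 a), profileTime, profileTime]
  ring

theorem strictMono_profileTime (hq : 0 ≤ q) (hC : 0 < C) : StrictMono (profileTime q C) := by
  intro a b hab
  rw [← sub_pos, profileTime_sub hq]
  refine mul_pos hC (intervalIntegral.integral_pos hab
    (continuous_abs_one_sub_sq_rpow hq).continuousOn (fun x _ => by positivity) ?_)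
  -- A quadratic cannot vanish at `a`, at `b` and at their midpoint.
  have key : ∃ c ∈ Icc a b, 1 - c ^ 2 ≠ 0 := by
    by_contra! H
    have h1 := H a (left_mem_Icc.2 hab.le)
    have h2 := H b (right_mem_Icc.2 hab.le)
    have h3 := H ((a + b) / 2) ⟨by linarith, by linarith⟩
    nlinarith [mul_pos (sub_pos.2 hab) (sub_pos.2 hab)]
  obtain ⟨c, hc, hc'⟩ := key
  exact ⟨c, hc, Real.rpow_pos_of_pos (abs_pos.2 hc') _⟩

/-- Thanks to the absolute value the integrand is at least `1` beyond `2`, which gives linear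
growth; oddness treats `-∞`. The inverse is thus defined on all of `ℝ`, not only on the support of
the profile. -/
theorem surjective_profileTime (hq : 0 ≤ q) (hC : 0 < C) :
    Function.Surjective (profileTime q C) := by
  have htop : Tendsto (profileTime q C) atTop atTop := by
    refine tendsto_atTop_mono' (f₁ := fun z => C * (z - 2) + profileTime q C 2) _ ?_
      (tendsto_atTop_add_const_right _ _ ((tendsto_atTop_add_const_right _ (-2 : ℝ)
        tendsto_id).const_mul_atTop hC))
    filter_upwards [eventually_ge_atTop 2] with z hz
    rw [← le_sub_iff_add_le, profileTime_sub hq]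
    refine mul_le_mul_of_nonneg_left ?_ hC.le
    have h1 : ∫ t in (2 : ℝ)..z, (1 : ℝ) = z - 2 := by simp
    rw [← h1]
    refine intervalIntegral.integral_mono_on hz (by simp)
      ((continuous_abs_one_sub_sq_rpow hq).intervalIntegrable _ _) fun t ht => ?_
    refine Real.one_le_rpow ?_ hq
    rw [abs_sub_comm]
    refine le_trans ?_ (le_abs_self _)
    nlinarith [ht.1]
  refine (continuous_profileTime hq C).surjective htop ?_
  have := tendsto_neg_atTop_atBot.comp (htop.comp tendsto_neg_atBot_atTop)
  refine this.congr fun z => ?_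
  simp [profileTime_neg]

theorem profileTime_profileCoord (hq : 0 ≤ q) (hC : 0 < C) (x : ℝ) :
    profileTime q C (profileCoord q C x) = x :=
  Function.rightInverse_invFun (surjective_profileTime hq hC) x

theorem profileCoord_profileTime (hq : 0 ≤ q) (hC : 0 < C) (z : ℝ) :
    profileCoord q C (profileTime q C z) = z :=
  Function.leftInverse_invFun (strictMono_profileTime hq hC).injective z

theorem strictMono_profileCoord (hq : 0 ≤ q) (hC : 0 < C) : StrictMono (profileCoord q C) := by
  intro x y hxy
  rwa [← (strictMono_profileTime hq hC).lt_iff_lt, profileTime_profileCoord hq hC,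
    profileTime_profileCoord hq hC]

theorem continuous_profileCoord (hq : 0 ≤ q) (hC : 0 < C) : Continuous (profileCoord q C) :=
  (strictMono_profileCoord hq hC).monotone.continuous_of_surjective fun z =>
    ⟨_, profileCoord_profileTime hq hC z⟩

theorem profileCoord_neg (hq : 0 ≤ q) (hC : 0 < C) (x : ℝ) :
    profileCoord q C (-x) = -profileCoord q C x := by
  apply (strictMono_profileTime hq hC).injective
  rw [profileTime_neg, profileTime_profileCoord hq hC, profileTime_profileCoord hq hC]

theorem profileCoord_zero (hq : 0 ≤ q) (hC : 0 < C) : profileCoord q C 0 = 0 := by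
  have := profileCoord_profileTime hq hC 0
  rwa [profileTime_zero] at this

theorem hasDerivAt_profileCoord (hq : 0 ≤ q) (hC : 0 < C) {x : ℝ}
    (hx : 1 - profileCoord q C x ^ 2 ≠ 0) :
    HasDerivAt (profileCoord q C) (C * |1 - profileCoord q C x ^ 2| ^ q)⁻¹ x :=
  HasDerivAt.of_local_left_inverse (continuous_profileCoord hq hC).continuousAt
    (hasDerivAt_profileTime hq C _)
    (mul_pos hC (Real.rpow_pos_of_pos (abs_pos.2 hx) _)).ne'
    (Eventually.of_forall (profileTime_profileCoord hq hC))

/-- Bootstrap: the coordinate `Z` satisfies `Z' = (C (1 - Z²)^q)⁻¹`, whose right side is as smooth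
as `Z` where `1 - Z² > 0`. -/
theorem contDiffOn_profileCoord (hq : 0 ≤ q) (hC : 0 < C) :
    ContDiffOn ℝ ∞ (profileCoord q C) {x | 0 < 1 - profileCoord q C x ^ 2} := by
  have hZ := continuous_profileCoord hq hC
  have hU : IsOpen {x | 0 < 1 - profileCoord q C x ^ 2} :=
    isOpen_lt continuous_const (by fun_prop)
  refine contDiffOn_infty.2 fun n => ?_
  induction n with
  | zero => exact contDiffOn_zero.2 hZ.continuousOn
  | succ n ih =>
    push_cast
    rw [contDiffOn_succ_iff_deriv_of_isOpen hU]
    refine ⟨fun x hx => (hasDerivAt_profileCoord hq hC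
      (ne_of_gt hx)).differentiableAt.differentiableWithinAt, by simp, ?_⟩
    have e : ∀ x ∈ {x | 0 < 1 - profileCoord q C x ^ 2},
        deriv (profileCoord q C) x = (C * (1 - profileCoord q C x ^ 2) ^ q)⁻¹ := fun x hx => by
      rw [(hasDerivAt_profileCoord hq hC (ne_of_gt hx)).deriv, abs_of_pos hx]
    refine ContDiffOn.congr ?_ e
    refine ContDiffOn.inv (contDiffOn_const.mul (ContDiffOn.rpow_const_of_ne
      (contDiffOn_const.sub (ih.pow 2)) fun x hx => ne_of_gt hx)) fun x hx => ?_
    exact (mul_pos hC (Real.rpow_pos_of_pos hx _)).ne'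

theorem profileCap_nonneg (q C x : ℝ) : 0 ≤ profileCap q C x := le_max_right _ _

theorem profileCap_le_one (q C x : ℝ) : profileCap q C x ≤ 1 :=
  max_le (by nlinarith [sq_nonneg (profileCoord q C x)]) zero_le_one

theorem profileCap_neg (hq : 0 ≤ q) (hC : 0 < C) (x : ℝ) :
    profileCap q C (-x) = profileCap q C x := by
  simp [profileCap, profileCoord_neg hq hC]

theorem continuous_profileCap (hq : 0 ≤ q) (hC : 0 < C) : Continuous (profileCap q C) :=
  (continuous_const.sub ((continuous_profileCoord hq hC).pow 2)).max continuous_const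

theorem profileCap_eq_zero (hq : 0 ≤ q) (hC : 0 < C) {x : ℝ}
    (hx : x ∉ Ioo (profileTime q C (-1)) (profileTime q C 1)) : profileCap q C x = 0 := by
  refine max_eq_right ?_
  have hm := strictMono_profileTime hq hC
  rw [mem_Ioo, not_and_or, not_lt, not_lt, ← profileTime_profileCoord hq hC x,
    hm.le_iff_le, hm.le_iff_le] at hx
  rcases hx with h | h <;> nlinarith

end Time

/-! ### Shape and regularity of the extremal profile -/

section Extremal

variable {q C M : ℝ}

theorem extremalProfile_nonneg (hM : 0 ≤ M) (x : ℝ) : 0 ≤ extremalProfile q C M x :=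
  mul_nonneg hM (Real.rpow_nonneg (profileCap_nonneg _ _ _) _)

theorem extremalProfile_neg (hq : 0 ≤ q) (hC : 0 < C) (x : ℝ) :
    extremalProfile q C M (-x) = extremalProfile q C M x := by
  simp [extremalProfile, profileCap_neg hq hC]

theorem continuous_extremalProfile (hq : 0 ≤ q) (hC : 0 < C) :
    Continuous (extremalProfile q C M) :=
  continuous_const.mul ((continuous_profileCap hq hC).rpow_const fun _ => Or.inr (by positivity))

theorem continuous_extremalDeriv (hq : 0 ≤ q) (hC : 0 < C) :
    Continuous (extremalDeriv q C M) :=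
  (continuous_const.mul (continuous_profileCoord hq hC)).mul
    ((continuous_profileCap hq hC).rpow_const fun _ => Or.inr hq)

theorem extremalProfile_eq_zero (hq : 0 ≤ q) (hC : 0 < C) {x : ℝ}
    (hx : x ∉ Ioo (profileTime q C (-1)) (profileTime q C 1)) : extremalProfile q C M x = 0 := by
  rw [extremalProfile, profileCap_eq_zero hq hC hx, Real.zero_rpow (by positivity), mul_zero]

theorem extremalDeriv_eq_zero (hq : 0 < q) (hC : 0 < C) {x : ℝ}
    (hx : x ∉ Ioo (profileTime q C (-1)) (profileTime q C 1)) : extremalDeriv q C M x = 0 := by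
  rw [extremalDeriv, profileCap_eq_zero hq.le hC hx, Real.zero_rpow hq.ne', mul_zero]

theorem hasCompactSupport_extremalProfile (hq : 0 ≤ q) (hC : 0 < C) :
    HasCompactSupport (extremalProfile q C M) :=
  HasCompactSupport.intro isCompact_Icc fun _ hx =>
    extremalProfile_eq_zero hq hC fun h => hx (Ioo_subset_Icc_self h)

theorem hasCompactSupport_extremalDeriv (hq : 0 < q) (hC : 0 < C) :
    HasCompactSupport (extremalDeriv q C M) :=
  HasCompactSupport.intro isCompact_Icc fun _ hx =>
    extremalDeriv_eq_zero hq hC fun h => hx (Ioo_subset_Icc_self h)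

theorem antitoneOn_extremalProfile (hq : 0 ≤ q) (hC : 0 < C) (hM : 0 ≤ M) :
    AntitoneOn (extremalProfile q C M) (Ici 0) := by
  intro x hx y _ hxy
  have hm := (strictMono_profileCoord hq hC).monotone
  have h0 : 0 ≤ profileCoord q C x := by
    rw [← profileCoord_zero hq hC]; exact hm hx
  have h1 := hm hxy
  refine mul_le_mul_of_nonneg_left (Real.rpow_le_rpow (profileCap_nonneg _ _ _)
    (max_le_max_right _ ?_) (by positivity)) hM
  nlinarith

theorem extremalProfile_pos_iff (hq : 0 ≤ q) (hM : 0 < M) {x : ℝ} :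
    0 < extremalProfile q C M x ↔ 0 < 1 - profileCoord q C x ^ 2 := by
  constructor
  · intro h
    by_contra! H
    rw [extremalProfile, profileCap, max_eq_right H, Real.zero_rpow (by positivity),
      mul_zero] at h
    exact lt_irrefl _ h
  · intro h
    exact mul_pos hM (Real.rpow_pos_of_pos (lt_max_of_lt_left h) _)

theorem extremalProfile_zero (hq : 0 ≤ q) (hC : 0 < C) : extremalProfile q C M 0 = M := by
  simp [extremalProfile, profileCap, profileCoord_zero hq hC]

theorem extremalProfile_lt (hq : 0 ≤ q) (hC : 0 < C) (hM : 0 < M) {x : ℝ} (hx : x ≠ 0) :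
    extremalProfile q C M x < M := by
  have h0 : profileCoord q C x ≠ 0 := fun h =>
    hx ((strictMono_profileCoord hq hC).injective (h.trans (profileCoord_zero hq hC).symm))
  have h1 : profileCap q C x < 1 := max_lt (by have := sq_pos_of_ne_zero h0; linarith) one_pos
  have := Real.rpow_lt_one (profileCap_nonneg q C x) h1 (by positivity : 0 < 2 * q + 1)
  exact mul_lt_of_lt_one_right hM this

theorem extremalProfile_le (hq : 0 ≤ q) (hC : 0 < C) (hM : 0 < M) (x : ℝ) :
    extremalProfile q C M x ≤ M := by
  rcases eq_or_ne x 0 with rfl | hx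
  · exact (extremalProfile_zero hq hC).le
  · exact (extremalProfile_lt hq hC hM hx).le

theorem contDiffOn_extremalProfile (hq : 0 ≤ q) (hC : 0 < C) (hM : 0 < M) :
    ContDiffOn ℝ ∞ (extremalProfile q C M) {x | 0 < extremalProfile q C M x} := by
  simp_rw [extremalProfile_pos_iff hq hM]
  have : ContDiffOn ℝ ∞ (fun x => M * (1 - profileCoord q C x ^ 2) ^ (2 * q + 1))
      {x | 0 < 1 - profileCoord q C x ^ 2} :=
    contDiffOn_const.mul (ContDiffOn.rpow_const_of_ne
      (contDiffOn_const.sub ((contDiffOn_profileCoord hq hC).pow 2)) fun x hx => ne_of_gt hx)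
  refine this.congr fun x hx => ?_
  rw [extremalProfile, profileCap, max_eq_left (le_of_lt hx)]

/-- With `u = 1 - z²`, differentiating `u^(2q+1)` produces `u^(2q)`, and the derivative of the
coordinate cancels one factor `u^q`. -/
theorem hasDerivAt_extremalProfile (hq : 0 < q) (hC : 0 < C) {x : ℝ}
    (hx : 1 - profileCoord q C x ^ 2 ≠ 0) :
    HasDerivAt (extremalProfile q C M) (extremalDeriv q C M x) x := by
  have hc : Continuous fun y => 1 - profileCoord q C y ^ 2 :=
    continuous_const.sub ((continuous_profileCoord hq.le hC).pow 2)
  rcases hx.lt_or_gt with h | h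
  · have e : extremalProfile q C M =ᶠ[𝓝 x] fun _ => M * 0 ^ (2 * q + 1) := by
      filter_upwards [(isOpen_lt hc continuous_const).mem_nhds h] with y hy
      rw [extremalProfile, profileCap, max_eq_right (le_of_lt hy)]
    rw [extremalDeriv, profileCap, max_eq_right h.le, Real.zero_rpow hq.ne', mul_zero]
    exact (hasDerivAt_const x _).congr_of_eventuallyEq e
  · have e : extremalProfile q C M =ᶠ[𝓝 x]
        fun y => M * (1 - profileCoord q C y ^ 2) ^ (2 * q + 1) := by
      filter_upwards [(isOpen_lt continuous_const hc).mem_nhds h] with y hy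
      rw [extremalProfile, profileCap, max_eq_left (le_of_lt hy)]
    refine HasDerivAt.congr_of_eventuallyEq ?_ e
    have hd := (((hasDerivAt_profileCoord hq.le hC hx).pow 2).const_sub 1).rpow_const
      (p := 2 * q + 1) (Or.inl hx) |>.const_mul M
    refine hd.congr_deriv ?_
    rw [extremalDeriv, profileCap, max_eq_left h.le, abs_of_pos h, Pi.pow_apply]
    set u := 1 - profileCoord q C x ^ 2
    have hu : 0 < u ^ q := Real.rpow_pos_of_pos h q
    rw [show 2 * q + 1 - 1 = q + q by ring, Real.rpow_add h]
    simp only [Nat.cast_ofNat, Nat.add_one_sub_one, pow_one]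
    field_simp

theorem isLocPrimitive_extremalProfile (hq : 0 < q) (hC : 0 < C) :
    IsLocPrimitive (extremalProfile q C M) (extremalDeriv q C M) where
  locallyIntegrable := (continuous_extremalDeriv hq.le hC).locallyIntegrable
  sub_eq a b := by
    -- The two ends of the support, where `z = ±1`, are the only exceptional points.
    refine (integral_eq_of_hasDerivAt_off_countable _ _
      (s := {profileTime q C 1, profileTime q C (-1)}) ((countable_singleton _).insert _)
      (continuous_extremalProfile hq.le hC).continuousOn (fun x hx => ?_)
      ((continuous_extremalDeriv hq.le hC).intervalIntegrable _ _)).symm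
    refine hasDerivAt_extremalProfile hq hC fun h => hx.2 ?_
    have : (profileCoord q C x - 1) * (profileCoord q C x + 1) = 0 := by linarith
    rcases mul_eq_zero.1 this with h | h
    · left
      rw [← profileTime_profileCoord hq.le hC x, sub_eq_zero.1 h]
    · right
      rw [mem_singleton_iff, ← profileTime_profileCoord hq.le hC x, eq_neg_of_add_eq_zero_left h]

end Extremal

/-! ### The extremal profile solves the first order equation -/

section Extremal

variable {β q C M : ℝ}

theorem isEnergyProfile_extremalProfile (hβ : 0 < β) (hq : 0 < q) (hC : 0 < C) (hM : 0 ≤ M) :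
    IsEnergyProfile β (extremalProfile q C M) (extremalDeriv q C M) where
  toIsLocPrimitive := isLocPrimitive_extremalProfile hq hC
  nonneg := extremalProfile_nonneg hM
  integrable := (continuous_extremalProfile hq.le hC).integrable_of_hasCompactSupport
    (hasCompactSupport_extremalProfile hq.le hC)
  integrable_rpow := by
    have h1 : Continuous fun x => extremalProfile q C M x ^ β :=
      (continuous_extremalProfile hq.le hC).rpow_const fun _ => Or.inr hβ.le
    refine h1.integrable_of_hasCompactSupport ?_
    exact (hasCompactSupport_extremalProfile hq.le hC).comp_left (g := fun y : ℝ => y ^ β)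
      (Real.zero_rpow hβ.ne')
  integrable_sq := by
    have h1 : Continuous fun x => extremalDeriv q C M x ^ 2 :=
      (continuous_extremalDeriv hq.le hC).pow 2
    refine h1.integrable_of_hasCompactSupport ?_
    exact (hasCompactSupport_extremalDeriv hq hC).comp_left (g := fun y : ℝ => y ^ 2)
      (zero_pow two_ne_zero)

/-- This is why `q` is tied to `β`: the substitution `s = u^(2q+1)` gives `s^β = u^(2q)`, so `s^β -
s = u^(2q) (1 - u)`. Taking `u = 1 - z²` then removes the remaining root. -/
theorem sqrt_rpow_sub_rpow {u : ℝ} (hq : 0 < q) (hβ : β * (2 * q + 1) = 2 * q) (hu : 0 ≤ u)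
    (hu1 : u ≤ 1) :
    √((u ^ (2 * q + 1)) ^ β - u ^ (2 * q + 1)) = u ^ q * √(1 - u) := by
  rcases hu.eq_or_lt with rfl | hu
  · rw [Real.zero_rpow (by positivity), Real.zero_rpow hq.ne']
    have : (0 : ℝ) ^ β - 0 = 0 := by
      rw [Real.zero_rpow, sub_zero]
      rintro rfl
      linarith
    rw [this]; simp
  · rw [← Real.rpow_mul hu.le, mul_comm (2 * q + 1), hβ, Real.rpow_add_one hu.ne', two_mul,
      Real.rpow_add hu, show u ^ q * u ^ q - u ^ q * u ^ q * u = (u ^ q) ^ 2 * (1 - u) by ring,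
      Real.sqrt_mul (sq_nonneg _), Real.sqrt_sq (by positivity)]

theorem profileSlope_extremalProfile (hq : 0 < q) (hβ : β * (2 * q + 1) = 2 * q) (hM : 0 < M)
    (x : ℝ) : profileSlope β M (extremalProfile q C M x) =
      M ^ (β / 2) * (|profileCoord q C x| * profileCap q C x ^ q) := by
  have h0 := profileCap_nonneg q C x
  rw [extremalProfile, profileSlope_mul hM (Real.rpow_nonneg h0 _),
    sqrt_rpow_sub_rpow hq hβ h0 (profileCap_le_one q C x)]
  -- Where the cap vanishes, `|z|` may exceed `1` and differ from `√(1 - u)`, but the factor `u^q`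
  -- is zero.
  rcases h0.eq_or_lt with h | h
  · rw [← h, Real.zero_rpow hq.ne']; simp
  · have : profileCap q C x = 1 - profileCoord q C x ^ 2 :=
      (max_choice _ _).resolve_right h.ne'
    rw [show 1 - profileCap q C x = profileCoord q C x ^ 2 by rw [this]; ring, Real.sqrt_sq_eq_abs]
    ring

/-- The value of `C` for which the extremal profile of height `M` solves `|w'| = profileSlope β M w`. -/
noncomputable def extremalScale (β q M : ℝ) : ℝ := 2 * (2 * q + 1) * M ^ (1 - β / 2)

theorem extremalScale_pos (hq : 0 < q) (hM : 0 < M) : 0 < extremalScale β q M := by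
  have := Real.rpow_pos_of_pos hM (1 - β / 2)
  unfold extremalScale
  positivity

theorem extremalDeriv_eq (hq : 0 < q) (hM : 0 < M) (x : ℝ) :
    extremalDeriv q (extremalScale β q M) M x = -M ^ (β / 2) *
      (profileCoord q (extremalScale β q M) x * profileCap q (extremalScale β q M) x ^ q) := by
  have h : 2 * (2 * q + 1) * M / extremalScale β q M = M ^ (β / 2) := by
    have e : M = M ^ (1 - β / 2) * M ^ (β / 2) := by
      rw [← Real.rpow_add hM]; simp
    have := Real.rpow_pos_of_pos hM (1 - β / 2)
    rw [div_eq_iff (extremalScale_pos hq hM).ne', extremalScale]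
    nth_rw 1 [e]
    ring
  rw [extremalDeriv, h]
  ring

theorem extremalDeriv_of_nonpos (hq : 0 < q) (hβ : β * (2 * q + 1) = 2 * q) (hM : 0 < M) {x : ℝ}
    (hx : x ≤ 0) : extremalDeriv q (extremalScale β q M) M x =
      profileSlope β M (extremalProfile q (extremalScale β q M) M x) := by
  have hC := extremalScale_pos (β := β) hq hM
  have hz : profileCoord q (extremalScale β q M) x ≤ 0 := by
    rw [← profileCoord_zero hq.le hC]
    exact (strictMono_profileCoord hq.le hC).monotone hx
  rw [profileSlope_extremalProfile hq hβ hM, extremalDeriv_eq hq hM, abs_of_nonpos hz]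
  ring

theorem extremalDeriv_neg (hq : 0 < q) (hC : 0 < C) (x : ℝ) :
    extremalDeriv q C M (-x) = -extremalDeriv q C M x := by
  rw [extremalDeriv, profileCoord_neg hq.le hC, profileCap_neg hq.le hC, extremalDeriv]
  ring

theorem lipschitzWith_extremalProfile (hq : 0 < q) (hC : 0 < C) :
    ∃ L, LipschitzWith L (extremalProfile q C M) := by
  obtain ⟨L, hL⟩ := (continuous_extremalDeriv (M := M) hq.le hC).bounded_above_of_compact_support
    (hasCompactSupport_extremalDeriv hq hC)
  have hL0 : 0 ≤ L := (norm_nonneg _).trans (hL 0)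
  refine ⟨⟨L, hL0⟩, LipschitzWith.of_dist_le_mul fun x y => ?_⟩
  rw [dist_comm, Real.dist_eq, (isLocPrimitive_extremalProfile hq hC).sub_eq, ← Real.norm_eq_abs,
    dist_comm]
  exact intervalIntegral.norm_integral_le_of_norm_le_const fun t _ => hL t

theorem isRegularProfile_extremalProfile (hq : 0 < q) (hC : 0 < C) (hM : 0 < M) :
    IsRegularProfile (extremalProfile q C M) where
  nonneg := extremalProfile_nonneg hM.le
  hasCompactSupport := hasCompactSupport_extremalProfile hq.le hC
  lipschitz := lipschitzWith_extremalProfile hq hC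
  contDiffOn := contDiffOn_extremalProfile hq.le hC hM

theorem IsRegularProfile.comp_sub {w : ℝ → ℝ} (h : IsRegularProfile w) (a : ℝ) :
    IsRegularProfile fun x => w (x - a) where
  nonneg x := h.nonneg _
  hasCompactSupport := h.hasCompactSupport.comp_homeomorph (Homeomorph.subRight a)
  lipschitz := by
    obtain ⟨L, hL⟩ := h.lipschitz
    refine ⟨L, LipschitzWith.of_dist_le_mul fun x y => ?_⟩
    simpa using hL.dist_le_mul (x - a) (y - a)
  contDiffOn := h.contDiffOn.comp (contDiff_id.sub contDiff_const).contDiffOn fun _ hx => hx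

/-! ### Mass and energy of the extremal profile -/

/-- The integral of `(1 - z ^ 2) ^ (3 q + 1)` over `(-1, 1)`. -/
noncomputable def massIntegral (q : ℝ) : ℝ := ∫ z in (-1 : ℝ)..1, (1 - z ^ 2) ^ (3 * q + 1)

theorem one_sub_sq_nonneg {z : ℝ} (hz : z ∈ Icc (-1 : ℝ) 1) : 0 ≤ 1 - z ^ 2 := by
  nlinarith [hz.1, hz.2]

theorem continuous_one_sub_sq_rpow {r : ℝ} (hr : 0 ≤ r) :
    Continuous fun z : ℝ => (1 - z ^ 2) ^ r :=
  (by fun_prop : Continuous fun z : ℝ => 1 - z ^ 2).rpow_const fun _ => Or.inr hr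

theorem massIntegral_pos (hq : 0 < q) : 0 < massIntegral q := by
  refine intervalIntegral.integral_pos (by norm_num)
    (continuous_one_sub_sq_rpow (by positivity)).continuousOn (fun x hx =>
      Real.rpow_nonneg (one_sub_sq_nonneg ⟨hx.1.le, hx.2⟩) _) ⟨0, by norm_num, by norm_num⟩

theorem integral_extremalProfile (hq : 0 < q) (hC : 0 < C) :
    ∫ x, extremalProfile q C M x = M * C * massIntegral q := by
  have hc := continuous_extremalProfile (M := M) hq.le hC
  have h1 : ∫ x, extremalProfile q C M x =
      ∫ x in (profileTime q C (-1))..(profileTime q C 1), extremalProfile q C M x := by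
    refine (intervalIntegral.integral_eq_integral_of_support_subset fun x hx => ?_).symm
    refine Ioo_subset_Ioc_self ?_
    by_contra h
    exact hx (extremalProfile_eq_zero hq.le hC h)
  rw [h1, ← intervalIntegral.integral_comp_mul_deriv
    (fun z _ => hasDerivAt_profileTime hq.le C z)
    (continuous_const.mul (continuous_abs_one_sub_sq_rpow hq.le)).continuousOn hc, massIntegral,
    ← intervalIntegral.integral_const_mul]
  refine intervalIntegral.integral_congr fun z hz => ?_
  rw [uIcc_of_le (by norm_num)] at hz
  have hu := one_sub_sq_nonneg hz
  simp only [Function.comp_apply]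
  rw [extremalProfile, profileCap, profileCoord_profileTime hq.le hC, max_eq_left hu,
    abs_of_nonneg hu, show 3 * q + 1 = (2 * q + 1) + q by ring,
    Real.rpow_add_of_nonneg hu (by positivity) hq.le]
  ring

theorem hasDerivAt_one_sub_sq_rpow {r : ℝ} (hr : 1 ≤ r) (z : ℝ) :
    HasDerivAt (fun z : ℝ => (1 - z ^ 2) ^ r) (-(2 * z) * r * (1 - z ^ 2) ^ (r - 1)) z := by
  have h := ((hasDerivAt_id z).fun_pow 2).const_sub 1
  refine (h.rpow_const (Or.inr hr)).congr_deriv ?_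
  simp

/-- Integration by parts: `z (1 - z²)^(3q+1)` vanishes at both ends. -/
theorem massIntegral_eq (hq : 0 < q) :
    massIntegral q = 2 * (3 * q + 1) * ∫ z in (-1 : ℝ)..1, z ^ 2 * (1 - z ^ 2) ^ (3 * q) := by
  have hc1 := continuous_one_sub_sq_rpow (r := 3 * q + 1) (by positivity)
  have hc2 := continuous_one_sub_sq_rpow (r := 3 * q) (by positivity)
  have hd : ∀ z : ℝ, HasDerivAt (fun z : ℝ => z * (1 - z ^ 2) ^ (3 * q + 1))
      ((1 - z ^ 2) ^ (3 * q + 1) - 2 * (3 * q + 1) * (z ^ 2 * (1 - z ^ 2) ^ (3 * q))) z :=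
    fun z => by
      refine ((hasDerivAt_id z).mul
        (hasDerivAt_one_sub_sq_rpow (r := 3 * q + 1) (by linarith) z)).congr_deriv ?_
      simp only [id_eq, add_sub_cancel_right]
      ring
  have hcc : Continuous fun z : ℝ => 2 * (3 * q + 1) * (z ^ 2 * (1 - z ^ 2) ^ (3 * q)) := by
    fun_prop
  have := intervalIntegral.integral_eq_sub_of_hasDerivAt (a := -1) (b := 1) (fun z _ => hd z)
    ((hc1.sub hcc).intervalIntegrable _ _)
  rw [intervalIntegral.integral_sub (hc1.intervalIntegrable _ _) (hcc.intervalIntegrable _ _),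
    intervalIntegral.integral_const_mul] at this
  norm_num [Real.zero_rpow (show 3 * q + 1 ≠ 0 by positivity)] at this
  rw [massIntegral]
  linarith

/-- Substitution `t = (1 - z²)^(2q+1)` with `z` running from `-1` to `0`. -/
theorem slopeIntegral_eq (hβ₀ : 0 < β) (hq : 0 < q) (hβ : β * (2 * q + 1) = 2 * q) :
    slopeIntegral β = 2 * (2 * q + 1) * ∫ z in (-1 : ℝ)..0, z ^ 2 * (1 - z ^ 2) ^ (3 * q) := by
  have hc : Continuous fun t : ℝ => √(t ^ β - t) :=
    ((Real.continuous_rpow_const hβ₀.le).sub continuous_id).sqrt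
  have hc2 := continuous_one_sub_sq_rpow (r := 2 * q + 1 - 1) (by linarith)
  have := intervalIntegral.integral_comp_mul_deriv (a := -1) (b := 0)
    (fun z _ => hasDerivAt_one_sub_sq_rpow (r := 2 * q + 1) (by linarith) z)
    (by fun_prop) hc
  have e0 : (1 - (-1 : ℝ) ^ 2) ^ (2 * q + 1) = 0 := by
    norm_num [Real.zero_rpow (show 2 * q + 1 ≠ 0 by positivity)]
  have e1 : (1 - (0 : ℝ) ^ 2) ^ (2 * q + 1) = 1 := by norm_num
  rw [e0, e1] at this
  rw [slopeIntegral, ← this, ← intervalIntegral.integral_const_mul]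
  refine intervalIntegral.integral_congr fun z hz => ?_
  rw [uIcc_of_le (by norm_num)] at hz
  have hu := one_sub_sq_nonneg (Icc_subset_Icc_right zero_le_one hz)
  simp only [Function.comp_apply, add_sub_cancel_right]
  rw [sqrt_rpow_sub_rpow hq hβ hu (by nlinarith), sub_sub_cancel, Real.sqrt_sq_eq_abs,
    abs_of_nonpos hz.2, show 3 * q = q + 2 * q by ring,
    Real.rpow_add_of_nonneg hu hq.le (by positivity)]
  ring

/-- Both constants are multiples of the integral of `z² (1 - z²)^(3q)`. Their ratio is what makes
the height fixed by unit mass coincide with the critical point of `heightEnergy`. -/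
theorem massIntegral_eq_slopeIntegral (hβ₀ : 0 < β) (hq : 0 < q)
    (hβ : β * (2 * q + 1) = 2 * q) :
    (2 * q + 1) * massIntegral q = 2 * (3 * q + 1) * slopeIntegral β := by
  have hc : Continuous fun z : ℝ => z ^ 2 * (1 - z ^ 2) ^ (3 * q) :=
    (continuous_pow 2).mul (continuous_one_sub_sq_rpow (by positivity))
  have h := intervalIntegral.integral_comp_neg (a := -1) (b := 0)
    fun z : ℝ => z ^ 2 * (1 - z ^ 2) ^ (3 * q)
  simp only [neg_sq, neg_zero, neg_neg] at h
  rw [massIntegral_eq hq, slopeIntegral_eq hβ₀ hq hβ,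
    ← intervalIntegral.integral_add_adjacent_intervals
    (hc.intervalIntegrable (-1) 0) (hc.intervalIntegrable 0 1), ← h]
  ring

/-! ### The optimal height -/

/-- The height of the extremal profile of unit mass. -/
noncomputable def extremalHeight (β q : ℝ) : ℝ :=
  (2 * (2 * q + 1) * massIntegral q)⁻¹ ^ (2 - β / 2)⁻¹

theorem extremalHeight_pos (hq : 0 < q) : 0 < extremalHeight β q := by
  have := massIntegral_pos hq
  exact Real.rpow_pos_of_pos (by positivity) _

theorem extremalHeight_rpow (hq : 0 < q) (hβ : β < 1) :
    extremalHeight β q ^ (2 - β / 2) = (2 * (2 * q + 1) * massIntegral q)⁻¹ := by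
  have := massIntegral_pos hq
  exact Real.rpow_inv_rpow (by positivity) (by linarith)

theorem integral_extremalProfile_extremalHeight (hq : 0 < q) (hβ : β < 1) :
    ∫ x, extremalProfile q (extremalScale β q (extremalHeight β q)) (extremalHeight β q) x = 1 := by
  have hM := extremalHeight_pos (β := β) hq
  have hS := massIntegral_pos hq
  have h := extremalHeight_rpow hq hβ
  rw [show 2 - β / 2 = 1 + (1 - β / 2) by ring, Real.rpow_add hM, Real.rpow_one] at h
  rw [integral_extremalProfile hq (extremalScale_pos hq hM), extremalScale,
    show ∀ a b c d : ℝ, a * (b * c) * d = b * d * (a * c) by intros; ring, h]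
  exact mul_inv_cancel₀ (by positivity)

/-- The least energy of a profile of unit mass and height `M`. -/
noncomputable def heightEnergy (β M : ℝ) : ℝ := M ^ (β - 1) + 4 * slopeIntegral β * M ^ (1 + β / 2)

/-- The hypothesis `hc` says that the derivative vanishes at `N`. In the variable `t = log (M / N)`
both terms are exponentials, and their tangent lines at `t = 0` give the strict global bound. -/
theorem heightEnergy_lt (hβ₀ : 0 < β) (hβ₁ : β < 1) {M N c : ℝ} (hM : 0 < M) (hN : 0 < N)
    (hMN : M ≠ N) (hc : c * (1 + β / 2) * N ^ (2 - β / 2) = 1 - β) :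
    N ^ (β - 1) + c * N ^ (1 + β / 2) < M ^ (β - 1) + c * M ^ (1 + β / 2) := by
  set t := Real.log (M / N)
  have hMt : M = N * Real.exp t := by
    rw [Real.exp_log (by positivity)]; field_simp
  have ht : t ≠ 0 := by
    intro h
    rw [h, Real.exp_zero, mul_one] at hMt
    exact hMN hMt
  have hp : ∀ r : ℝ, M ^ r = N ^ r * Real.exp (r * t) := fun r => by
    rw [hMt, Real.mul_rpow hN.le (Real.exp_pos _).le, ← Real.exp_mul, mul_comm t]
  have hN1 : N ^ (1 + β / 2) = N ^ (β - 1) * N ^ (2 - β / 2) := by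
    rw [← Real.rpow_add hN]; ring_nf
  have h1 : (β - 1) * t + 1 < Real.exp ((β - 1) * t) :=
    Real.add_one_lt_exp (mul_ne_zero (by linarith) ht)
  have h2 : (1 + β / 2) * t + 1 < Real.exp ((1 + β / 2) * t) :=
    Real.add_one_lt_exp (mul_ne_zero (by linarith) ht)
  rw [hp, hp, hN1]
  set A := Real.exp ((β - 1) * t)
  set B := Real.exp ((1 + β / 2) * t)
  set P := N ^ (β - 1)
  set Q := N ^ (2 - β / 2)
  have hP : 0 < P := Real.rpow_pos_of_pos hN _
  -- With these weights the linear terms of the two tangent bounds cancel.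
  have key : 0 < (1 + β / 2) * (A - 1) + c * (1 + β / 2) * Q * (B - 1) := by
    rw [hc]
    nlinarith
  have key2 : 0 < (A - 1) + c * Q * (B - 1) := by
    have : (1 + β / 2) * ((A - 1) + c * Q * (B - 1)) =
      (1 + β / 2) * (A - 1) + c * (1 + β / 2) * Q * (B - 1) := by ring
    rw [← this] at key
    exact pos_of_mul_pos_right key (by linarith)
  nlinarith [mul_pos hP key2]

theorem extremalHeight_critical (hβ₀ : 0 < β) (hβ₁ : β < 1) (hq : 0 < q)
    (hβ : β * (2 * q + 1) = 2 * q) :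
    4 * slopeIntegral β * (1 + β / 2) * extremalHeight β q ^ (2 - β / 2) = 1 - β := by
  have hS := massIntegral_pos hq
  have h := massIntegral_eq_slopeIntegral hβ₀ hq hβ
  rw [extremalHeight_rpow hq hβ₁, ← div_eq_mul_inv, div_eq_iff (by positivity)]
  have e1 : (1 - β) * (2 * q + 1) = 1 := by linarith
  have e2 : (3 * q + 1) = (1 + β / 2) * (2 * q + 1) := by linarith
  rw [e2] at h
  have h' : massIntegral q = 2 * (1 + β / 2) * slopeIntegral β := by
    have : 2 * q + 1 ≠ 0 := by positivity
    apply mul_left_cancel₀ this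
    linarith
  linear_combination -2 * h' - 2 * massIntegral q * e1

theorem heightEnergy_extremalHeight_lt (hβ₀ : 0 < β) (hβ₁ : β < 1) (hq : 0 < q)
    (hβ : β * (2 * q + 1) = 2 * q) (hM : 0 < M) (hne : M ≠ extremalHeight β q) :
    heightEnergy β (extremalHeight β q) < heightEnergy β M :=
  heightEnergy_lt hβ₀ hβ₁ hM (extremalHeight_pos hq) hne (extremalHeight_critical hβ₀ hβ₁ hq hβ)

theorem realEnergy_extremalProfile (hβ₀ : 0 < β) (hβ₁ : β < 1) (hq : 0 < q)
    (hβ : β * (2 * q + 1) = 2 * q) :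
    realEnergy β (extremalProfile q (extremalScale β q (extremalHeight β q)) (extremalHeight β q))
      (extremalDeriv q (extremalScale β q (extremalHeight β q)) (extremalHeight β q)) =
      heightEnergy β (extremalHeight β q) := by
  have hM := extremalHeight_pos (β := β) hq
  have h1 := integral_extremalProfile_extremalHeight hq hβ₁
  set M := extremalHeight β q
  have hC := extremalScale_pos (β := β) hq hM
  have h0 := extremalProfile_zero (M := M) hq.le hC
  have h := (isEnergyProfile_extremalProfile hβ₀ hq hC hM.le).realEnergy_eq hβ₀ hβ₁.le (x₀ := 0)
    (by rwa [h0]) (fun x => by rw [h0]; exact extremalProfile_le hq.le hC hM x)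
  rw [h0, h1] at h
  rw [h, heightEnergy]
  have z : ∀ x ∈ Iic (0 : ℝ), (extremalDeriv q (extremalScale β q M) M x -
      profileSlope β M (extremalProfile q (extremalScale β q M) M x)) ^ 2 = 0 := fun x hx => by
    rw [extremalDeriv_of_nonpos hq hβ hM hx]; ring
  simp only [extremalDeriv_neg hq hC, extremalProfile_neg hq.le hC, neg_neg, neg_zero]
  rw [setIntegral_congr_fun measurableSet_Iic z]
  simp

end Extremal

/-! ### Uniqueness of the optimal profile up to translation -/

/-- The position at which the increasing half of the extremal profile of height `M` attains the
value `s`. -/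
noncomputable def levelPosition (β q M s : ℝ) : ℝ :=
  profileTime q (extremalScale β q M) (-√(1 - (s / M) ^ (2 * q + 1)⁻¹))

section Level

variable {β q M : ℝ}

theorem continuous_levelPosition (hq : 0 < q) : Continuous (levelPosition β q M) := by
  have h : Continuous fun s : ℝ => (s / M) ^ (2 * q + 1)⁻¹ :=
    (continuous_id.div_const M).rpow_const fun _ => Or.inr (by positivity)
  exact (continuous_profileTime hq.le _).comp (continuous_const.sub h).sqrt.neg

theorem levelPosition_top (hM : 0 < M) : levelPosition β q M M = 0 := by
  rw [levelPosition, div_self hM.ne', Real.one_rpow, sub_self, Real.sqrt_zero, neg_zero,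
    profileTime_zero]

theorem levelPosition_zero (hq : 0 < q) :
    levelPosition β q M 0 = profileTime q (extremalScale β q M) (-1) := by
  rw [levelPosition, zero_div, Real.zero_rpow (by positivity), sub_zero, Real.sqrt_one]

theorem extremalProfile_levelPosition (hq : 0 < q) (hM : 0 < M) {s : ℝ} (h0 : 0 ≤ s)
    (h1 : s ≤ M) : extremalProfile q (extremalScale β q M) M (levelPosition β q M s) = s := by
  have hs : 0 ≤ s / M := by positivity
  have hv1 : (s / M) ^ (2 * q + 1)⁻¹ ≤ 1 :=
    Real.rpow_le_one hs ((div_le_one hM).2 h1) (by positivity)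
  rw [extremalProfile, profileCap, levelPosition,
    profileCoord_profileTime hq.le (extremalScale_pos hq hM), neg_sq,
    Real.sq_sqrt (by linarith), sub_sub_cancel, max_eq_left (Real.rpow_nonneg hs _),
    Real.rpow_inv_rpow hs (by positivity)]
  field_simp

/-- Separation of variables: along a solution of `V' = k(V)` with `0 < V < M`, the level position of
`V` moves at unit speed. -/
theorem hasDerivAt_levelPosition (hq : 0 < q) (hβ : β * (2 * q + 1) = 2 * q) (hM : 0 < M) {s : ℝ}
    (h0 : 0 < s) (h1 : s < M) :
    profileSlope β M s ≠ 0 ∧ HasDerivAt (levelPosition β q M) (profileSlope β M s)⁻¹ s := by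
  have hs : 0 < s / M := by positivity
  set r := (2 * q + 1)⁻¹ with hr
  have hrp : 0 < r := by positivity
  set v := (s / M) ^ r with hv
  have hv0 : 0 < v := Real.rpow_pos_of_pos hs _
  have hv1 : v < 1 := Real.rpow_lt_one hs.le ((div_lt_one hM).2 h1) hrp
  have hvs : v ^ (2 * q + 1) = s / M := Real.rpow_inv_rpow hs.le (by positivity)
  have hsl : profileSlope β M s = M ^ (β / 2) * (v ^ q * √(1 - v)) := by
    rw [← sqrt_rpow_sub_rpow hq hβ hv0.le hv1.le, hvs, ← profileSlope_mul hM hs.le]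
    congr 1
    field_simp
  have hq0 : 0 < v ^ q := Real.rpow_pos_of_pos hv0 _
  have hr0 : 0 < √(1 - v) := Real.sqrt_pos.2 (by linarith)
  have hM0 : 0 < M ^ (β / 2) := Real.rpow_pos_of_pos hM _
  have hd1 : HasDerivAt (fun s : ℝ => (s / M) ^ r) (1 / M * r * (s / M) ^ (r - 1)) s :=
    ((hasDerivAt_id s).div_const M).rpow_const (Or.inl hs.ne')
  have hd2 := ((hd1.const_sub 1).sqrt (by change 1 - v ≠ 0; linarith)).neg
  have hd := (hasDerivAt_profileTime hq.le (extremalScale β q M) _).comp s hd2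
  refine ⟨by rw [hsl]; positivity, hd.congr_deriv ?_⟩
  have e1 : v ^ q * v ^ q * v = s / M := by
    rw [← hvs, Real.rpow_add_one hv0.ne', two_mul, Real.rpow_add hv0]
  have e2 : M = M ^ (1 - β / 2) * M ^ (β / 2) := by
    rw [← Real.rpow_add hM]; simp
  simp only [Pi.neg_apply, neg_sq]
  rw [← hv, Real.sq_sqrt (by linarith), sub_sub_cancel, abs_of_pos hv0, hsl,
    Real.rpow_sub_one hs.ne', ← hv, extremalScale]
  have hrq : r * (2 * q + 1) = 1 := inv_mul_cancel₀ (by positivity)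
  refine eq_inv_of_mul_eq_one_left ?_
  set A := v ^ q
  set B := √(1 - v)
  set P := M ^ (1 - β / 2)
  set Q := M ^ (β / 2)
  have : s / M = A * A * v := e1.symm
  rw [this]
  field_simp
  linear_combination (P * Q) * hrq - e2

end Level

/-! ### Rigidity in the equality case -/

namespace IsEnergyProfile

variable {β q : ℝ} {V f : ℝ → ℝ}

theorem sub_eq_integral_slope (h : IsEnergyProfile β V f) {M x₀ : ℝ}
    (hf : ∀ᵐ x ∂volume.restrict (Iic x₀), f x = profileSlope β M (V x)) {x y : ℝ} (hx : x ≤ x₀)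
    (hy : y ≤ x₀) : V y - V x = ∫ t in x..y, profileSlope β M (V t) := by
  rw [h.sub_eq]
  refine intervalIntegral.integral_congr_ae ?_
  filter_upwards [(ae_restrict_iff' measurableSet_Iic).1 hf] with t ht htt
  exact ht (htt.2.trans (max_le hx hy))

/-- A profile that solves the first order equation to the left of its maximum is there a translate
of the extremal profile, followed by a plateau. -/
theorem exists_eq_extremalProfile (h : IsEnergyProfile β V f) (hβ₀ : 0 < β) (hq : 0 < q)
    (hβ : β * (2 * q + 1) = 2 * q) {M x₀ : ℝ} (hM : 0 < M) (hx₀ : V x₀ = M) (hVM : ∀ x, V x ≤ M)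
    (hf : ∀ᵐ x ∂volume.restrict (Iic x₀), f x = profileSlope β M (V x)) :
    ∃ a ≤ x₀, (∀ x ≤ a, V x = extremalProfile q (extremalScale β q M) M (x - a)) ∧
      ∀ x ∈ Icc a x₀, V x = M := by
  have hV := h.toIsLocPrimitive.continuous
  have hC := extremalScale_pos (β := β) hq hM
  have hk : Continuous fun t => profileSlope β M (V t) := (continuous_profileSlope hβ₀ M).comp hV
  have hmono : ∀ x y, x ≤ y → y ≤ x₀ → V x ≤ V y := fun x y hxy hy => by
    rw [← sub_nonneg, h.sub_eq_integral_slope hf (hxy.trans hy) hy]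
    exact intervalIntegral.integral_nonneg hxy fun t _ => profileSlope_nonneg _ _ _
  have hderiv : ∀ x < x₀, HasDerivAt V (profileSlope β M (V x)) x := fun x hx => by
    have h1 := (intervalIntegral.integral_hasDerivAt_right (hk.intervalIntegrable x₀ x)
      (hk.stronglyMeasurableAtFilter _ _) hk.continuousAt).const_add (V x₀)
    refine h1.congr_of_eventuallyEq ?_
    filter_upwards [Iio_mem_nhds hx] with y hy
    rw [← h.sub_eq_integral_slope hf le_rfl (le_of_lt hy)]
    ring
  obtain ⟨N, hN⟩ := eventually_atBot.1 ((h.tendsto_atBot hβ₀).eventually (gt_mem_nhds hM))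
  -- `a` is the first point at height `M`; it exists because `V < M` far to the left. By
  -- monotonicity `V` stays at `M` from `a` to `x₀`.
  obtain ⟨a, ⟨hax, haM⟩, hal⟩ : ∃ a, IsLeast (Iic x₀ ∩ V ⁻¹' {M}) a :=
    ⟨_, (isClosed_Iic.inter (isClosed_singleton.preimage hV)).isLeast_csInf ⟨x₀, self_mem_Iic, hx₀⟩
      ⟨N, fun x hx => not_lt.1 fun hxN => (hN x hxN.le).ne hx.2⟩⟩
  have haM : V a = M := haM
  have hlt : ∀ x < a, V x < M := fun x hx =>
    (hVM x).lt_of_ne fun e => (hal ⟨hx.le.trans hax, e⟩).not_gt hx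
  have hc : Continuous fun x => levelPosition β q M (V x) := (continuous_levelPosition hq).comp hV
  have hpos : ∀ x ≤ a, 0 < V x → levelPosition β q M (V x) = x - a := fun x hx hx0 => by
    rcases hx.eq_or_lt with rfl | hx
    · rw [haM, levelPosition_top hM, sub_self]
    · obtain ⟨c, hc, e⟩ := exists_hasDerivAt_eq_slope (fun y => levelPosition β q M (V y))
        (fun _ => 1) hx hc.continuousOn fun y hy => by
          obtain ⟨h1, h2⟩ := hasDerivAt_levelPosition hq hβ hM
            (hx0.trans_le (hmono x y hy.1.le (hy.2.le.trans hax))) (hlt y hy.2)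
          refine (h2.comp y (hderiv y (hy.2.trans_le hax))).congr_deriv ?_
          exact inv_mul_cancel₀ h1
      rw [haM, levelPosition_top hM, eq_div_iff (sub_pos.2 hx).ne'] at e
      linarith
  refine ⟨a, hax, fun x hx => ?_, fun x hx => le_antisymm (hVM x) ?_⟩
  · rcases (h.nonneg x).eq_or_lt with h0 | h0
    -- `b` is the last zero before `a`. The position formula holds on `(b, a]` and extends to `b` by
    -- continuity, which identifies `b - a` with the left end of the support of the extremal
    -- profile.
    · obtain ⟨b, ⟨hba, hb0⟩, hbg⟩ : ∃ b, IsGreatest (Iic a ∩ V ⁻¹' {0}) b :=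
        ⟨_, (isClosed_Iic.inter (isClosed_singleton.preimage hV)).isGreatest_csSup
          ⟨x, hx, h0.symm⟩ ⟨a, fun y hy => hy.1⟩⟩
      have hb0 : V b = 0 := hb0
      have hba : b ≠ a := by
        rintro rfl
        linarith
      have hcl : IsClosed {y | levelPosition β q M (V y) = y - a} :=
        isClosed_eq hc (continuous_id.sub continuous_const)
      have hsub : Ioc b a ⊆ {y | levelPosition β q M (V y) = y - a} := fun y hy =>
        hpos y hy.2 ((h.nonneg y).lt_of_ne fun e => (hbg ⟨hy.2, e.symm⟩).not_gt hy.1)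
      have hb := hcl.closure_subset_iff.2 hsub
      rw [closure_Ioc hba] at hb
      have hb' : levelPosition β q M (V b) = b - a := hb (left_mem_Icc.2 ‹b ∈ Iic a›)
      rw [hb0, levelPosition_zero hq] at hb'
      have hxb : x ≤ b := hbg ⟨hx, h0.symm⟩
      rw [← h0, extremalProfile_eq_zero hq.le hC fun hm => ?_]
      linarith [hm.1]
    · rw [← hpos x hx h0, extremalProfile_levelPosition hq hM h0.le (hVM x)]
  · rw [← haM]
    exact hmono a x hx.1 hx.2

theorem ae_eq_slope (h : IsEnergyProfile β V f) (hβ₀ : 0 < β) (hβ₁ : β ≤ 1) {M x₀ : ℝ}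
    (hM : 0 < M) (hVM : ∀ x, V x ≤ M)
    (h0 : ∫ x in Iic x₀, (f x - profileSlope β M (V x)) ^ 2 = 0) :
    ∀ᵐ x ∂volume.restrict (Iic x₀), f x = profileSlope β M (V x) := by
  rw [integral_eq_zero_iff_of_nonneg (fun _ => sq_nonneg _)
    (h.integrable_sub_slope_sq hβ₀ hβ₁ hM hVM).integrableOn] at h0
  filter_upwards [h0] with x hx
  exact sub_eq_zero.1 (pow_eq_zero_iff two_ne_zero |>.1 hx)

theorem heightEnergy_le (h : IsEnergyProfile β V f) (hβ₀ : 0 < β) (hβ₁ : β < 1) (hq : 0 < q)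
    (hβ : β * (2 * q + 1) = 2 * q) (h1 : ∫ x, V x = 1) :
    heightEnergy β (extremalHeight β q) ≤ realEnergy β V f := by
  obtain ⟨x₀, hM, hVM⟩ := h.exists_isMax hβ₀ (by rw [h1]; exact one_ne_zero)
  have e := h.realEnergy_eq hβ₀ hβ₁.le hM hVM
  have d1 : 0 ≤ ∫ x in Iic x₀, (f x - profileSlope β (V x₀) (V x)) ^ 2 :=
    integral_nonneg fun x => sq_nonneg _
  have d2 : 0 ≤ ∫ x in Iic (-x₀), (-f (-x) - profileSlope β (V x₀) (V (-x))) ^ 2 :=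
    integral_nonneg fun x => sq_nonneg _
  rw [h1, mul_one, ← heightEnergy] at e
  rcases eq_or_ne (V x₀) (extremalHeight β q) with hE | hE
  · rw [← hE, e]; linarith
  · have := heightEnergy_extremalHeight_lt hβ₀ hβ₁ hq hβ hM hE
    rw [e]; linarith

theorem eq_extremalProfile (h : IsEnergyProfile β V f) (hβ₀ : 0 < β) (hβ₁ : β < 1) (hq : 0 < q)
    (hβ : β * (2 * q + 1) = 2 * q) (h1 : ∫ x, V x = 1)
    (hmin : realEnergy β V f ≤ heightEnergy β (extremalHeight β q)) :
    ∃ a, V = fun x => extremalProfile q (extremalScale β q (extremalHeight β q))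
      (extremalHeight β q) (x - a) := by
  obtain ⟨x₀, hM, hVM⟩ := h.exists_isMax hβ₀ (by rw [h1]; exact one_ne_zero)
  have e := h.realEnergy_eq hβ₀ hβ₁.le hM hVM
  have d1 : 0 ≤ ∫ x in Iic x₀, (f x - profileSlope β (V x₀) (V x)) ^ 2 :=
    integral_nonneg fun x => sq_nonneg _
  have d2 : 0 ≤ ∫ x in Iic (-x₀), (-f (-x) - profileSlope β (V x₀) (V (-x))) ^ 2 :=
    integral_nonneg fun x => sq_nonneg _
  rw [h1, mul_one, ← heightEnergy] at e
  have hE : V x₀ = extremalHeight β q := by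
    by_contra hE
    have := heightEnergy_extremalHeight_lt hβ₀ hβ₁ hq hβ hM hE
    linarith
  have hw1 := integral_extremalProfile_extremalHeight (β := β) hq hβ₁
  rw [← hE] at hmin hw1 ⊢
  set M := V x₀ with hMdef
  have hC := extremalScale_pos (β := β) hq hM
  set w := extremalProfile q (extremalScale β q M) M
  have hVM' : ∀ x, V (-x) ≤ M := fun x => hVM (-x)
  obtain ⟨a, ha, hVa, hpa⟩ := h.exists_eq_extremalProfile hβ₀ hq hβ hM hMdef.symm hVM
    (h.ae_eq_slope hβ₀ hβ₁.le hM hVM (by linarith))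
  obtain ⟨b, hb, hVb, hpb⟩ := h.comp_neg.exists_eq_extremalProfile (x₀ := -x₀) hβ₀ hq hβ hM
    (by simp [hMdef]) hVM' (h.comp_neg.ae_eq_slope hβ₀ hβ₁.le hM hVM' (by linarith))
  have hwc : Continuous fun x => w (x - a) :=
    (continuous_extremalProfile hq.le hC).comp (continuous_id.sub continuous_const)
  have hwi : Integrable w :=
    (isEnergyProfile_extremalProfile hβ₀ hq hC hM.le).integrable
  -- `V` is a half-profile up to `a`, the constant `M` on `[a, -b]` and a half-profile after `-b`.
  -- On the last piece `V x = w (x + b)` with `0 ≤ x + b ≤ x - a`, and `w` decreases there.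
  have hle : ∀ x, w (x - a) ≤ V x := fun x => by
    rcases le_total x a with hx | hx
    · exact (hVa x hx).ge
    · rcases le_total x (-b) with hxb | hxb
      · have : V x = M := by
          rcases le_total x x₀ with hx0 | hx0
          · exact hpa x ⟨hx, hx0⟩
          · have := hpb (-x) ⟨by linarith, by linarith⟩
            rwa [neg_neg] at this
        rw [this]
        exact extremalProfile_le hq.le hC hM _
      · have := hVb (-x) (by linarith)
        rw [neg_neg, ← extremalProfile_neg hq.le hC] at this
        rw [this]
        exact antitoneOn_extremalProfile hq.le hC hM.le (mem_Ici.2 (by linarith))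
          (mem_Ici.2 (by linarith)) (by linarith)
  -- Both functions have unit mass, so the pointwise inequality is an equality and no plateau
  -- remains.
  have h0 : ∫ x, (V x - w (x - a)) = 0 := by
    rw [integral_sub h.integrable (hwi.comp_sub_right a), integral_sub_right_eq_self w a, h1, hw1,
      sub_self]
  rw [integral_eq_zero_iff_of_nonneg (fun x => sub_nonneg.2 (hle x))
    (h.integrable.sub (hwi.comp_sub_right a))] at h0
  refine ⟨a, (h.toIsLocPrimitive.continuous.ae_eq_iff_eq volume hwc).1 ?_⟩
  filter_upwards [h0] with x hx
  exact sub_eq_zero.1 hx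

end IsEnergyProfile

/-! ### Conclusion -/

theorem mainTheorem7 (β : ℝ) (hβ₀ : 0 < β) (hβ₁ : β < 1) :
    (∃ w : ℝ → ℝ, IsOptimalProfile β w ∧ IsRegularProfile w ∧
      (∀ x, w (-x) = w x) ∧ AntitoneOn w (Ici 0)) ∧
    (∀ w : ℝ → ℝ, IsOptimalProfile β w →
      ∃ v : ℝ → ℝ, v =ᵐ[volume] w ∧ IsRegularProfile v) := by
  have h1β : 0 < 1 - β := by linarith
  obtain ⟨q, hq, hβ⟩ : ∃ q : ℝ, 0 < q ∧ β * (2 * q + 1) = 2 * q :=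
    -- Equivalently `2q + 1 = 1 / (1 - β)`.
    ⟨β / (2 * (1 - β)), by positivity, by field_simp; ring⟩
  have hM := extremalHeight_pos (β := β) hq
  have hC := extremalScale_pos (β := β) hq hM
  have hE := isEnergyProfile_extremalProfile hβ₀ hq hC hM.le
  have h1 := integral_extremalProfile_extremalHeight (β := β) hq hβ₁
  have hreg := isRegularProfile_extremalProfile hq hC hM
  have hval := realEnergy_extremalProfile hβ₀ hβ₁ hq hβ
  refine ⟨⟨_, ⟨_, hE.isAdmissible h1, fun v v' hv => ?_⟩, hreg, extremalProfile_neg hq.le hC,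
    antitoneOn_extremalProfile hq.le hC hM.le⟩, ?_⟩
  · rcases eq_or_ne (profileEnergy β v v') ⊤ with htop | htop
    · rw [htop]; exact le_top
    · obtain ⟨V, -, hV, hV1, hVE⟩ := hv.exists_isEnergyProfile htop
      rw [hVE, hE.profileEnergy_eq, hval]
      exact ENNReal.ofReal_le_ofReal (hV.heightEnergy_le hβ₀ hβ₁ hq hβ hV1)
  · rintro w ⟨w', hw, hmin⟩
    -- Comparison with the explicit profile shows that a solution has finite energy and attains the
    -- lower bound.
    have hle := hmin _ _ (hE.isAdmissible h1)
    rw [hE.profileEnergy_eq] at hle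
    obtain ⟨V, hVw, hV, hV1, hVE⟩ := hw.exists_isEnergyProfile (ne_top_of_le_ne_top
      ENNReal.ofReal_ne_top hle)
    rw [hVE, ENNReal.ofReal_le_ofReal_iff hE.realEnergy_nonneg, hval] at hle
    obtain ⟨a, ha⟩ := hV.eq_extremalProfile hβ₀ hβ₁ hq hβ hV1 hle
    exact ⟨V, hVw, ha ▸ hreg.comp_sub a⟩
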